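/- Fix a full sub-$2$-category $\mathrm{Dia}$ of the $2$-category of small categories which contains all finite posets and is closed under opposites, finite coproducts, finite products and comma categories. A \emph{prederivator} is a strict $2$-functor $\mathbb{D}$ from $\mathrm{Dia}$ to categories, contravariant on functors and covariant on natural transformations; write $f^*=\mathbb{D}(f)$. It is a \emph{right derivator} if: (1) $\mathbb{D}(X\sqcup Y)\to\mathbb{D}(X)\times\mathbb{D}(Y)$ is an equivalence for all $X,Y$, and $\mathbb{D}(\varnothing)$ is equivalent to the final category $e$; (2) a morphism of $\mathbb{D}(X)$ is invertible if its restrictions along all objects $e\to X$ are; (3) every $f^*$ has a left adjoint $f_!$; (4) for all $f\colon X\to Y$ and $y\in Y$, with $j\colon f\downarrow y\to X$ and $p\colon f\downarrow y\to e$ the canonical functors and $i_y\colon e\to Y$ the object $y$, the Beck--Chevalley transformation $p_!j^*\Rightarrow i_y^*f_!$ is invertible. It is \emph{pointed} if all $\mathbb{D}(X)$ have zero objects and all $f^*$ preserve them. A \emph{strict morphism} $\phi\colon\mathbb{D}\to\mathbb{D}'$ is a strictly $2$-natural family of functors $\phi(X)\colon\mathbb{D}(X)\to\mathbb{D}'(X)$;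 it is an \emph{equivalence} if every $\phi(X)$ is an equivalence of categories, and \emph{cocontinuous} if all canonical maps $f_!\phi(X)\Rightarrow\phi(Y)f_!$ are invertible. Let $\mathrm{Ar}[n]$ be the poset of pairs $i\le j$ (written $i\to j$) in $[n]$. Let $S_n\mathbb{D}\subset\mathbb{D}(\mathrm{Ar}[n])$ be the full subcategory of those $F$ whose restriction to each $i\to i$ is a zero object and whose restriction to the square $(i\to j),(i\to k),(j\to j),(j\to k)$ is cocartesian for all $i\le j\le k$; here a square $G\in\mathbb{D}([1]\times[1])$ is cocartesian if the counit $\iota_!\iota^*G\to G$ is invertible, where $\iota\colon([1]\times[1])\setminus\{(1,1)\}\hookrightarrow[1]\times[1]$ is the inclusion. These form a simplicial category $S_\bullet\mathbb{D}$, functorial in cocontinuous strict morphisms. The derivator $K$-theory of a pointed right derivator $\mathbb{D}$ is the space $K(\mathbb{D})=\Omega\,|N_\bullet\operatorname{iso}S_\bullet\mathbb{D}|$, where $N_\bullet\operatorname{iso}$ is the nerve of the subcategory of isomorphisms, $|\cdot|$ is the geometric realization of the diagonal, and the loops are based at the vertex given by an object $z$ of $S_0\mathbb{D}$, i.e. a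 zero object of $\mathbb{D}(\mathrm{Ar}[0])$. \textbf{Proposition.} Let $\mathbb{D},\mathbb{D}'$ be pointed right derivators and let $\phi\colon\mathbb{D}\to\mathbb{D}'$ be a strict morphism which is an equivalence. Then $\phi$ is cocontinuous (so that $K(\phi)$ is defined), and for every choice of base point $z\in S_0\mathbb{D}$ the induced map $K(\phi)\colon K(\mathbb{D})\to K(\mathbb{D}')$, with $K(\mathbb{D}')$ based at $\phi(z)$, is a weak equivalence: it induces bijections on path components and on all homotopy groups at all base points. -/

import Mathlib

universe w v u

open CategoryTheory

/-! ### Categories of diagrams -/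

/-- A full sub-2-category `Dia` of the 2-category of small categories, given by its class of
objects. It contains all finite posets and is closed under opposites, binary coproducts, binary
products and comma categories. (It is full on functors and on natural transformations.) -/
structure DiagramCategory where
  /-- the class of objects of `Dia` -/
  Mem : Cat.{w, w} → Prop
  finitePoset : ∀ (P : Type w) [PartialOrder P] [Finite P], Mem (Cat.of P)
  opposite : ∀ X : Cat.{w, w}, Mem X → Mem (Cat.of Xᵒᵖ)
  coproduct : ∀ X Y : Cat.{w, w}, Mem X → Mem Y → Mem (Cat.of (X ⊕ Y))
  product : ∀ X Y : Cat.{w, w}, Mem X → Mem Y → Mem (Cat.of (X × Y))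
  comma : ∀ (X Y Z : Cat.{w, w}) (F : X ⥤ Z) (G : Y ⥤ Z), Mem X → Mem Y → Mem Z →
    Mem (Cat.of (Comma F G))

namespace DiagramCategory

variable (Dia : DiagramCategory.{w})

/-- An object of `Dia`. -/
structure Shape where
  cat : Cat.{w, w}
  mem : Dia.Mem cat

variable {Dia}

instance : CoeSort Dia.Shape (Type w) := ⟨fun X => X.cat⟩

variable (Dia)

/-- A finite poset, regarded as an object of `Dia`. -/
def poset (P : Type w) [PartialOrder P] [Finite P] : Dia.Shape :=
  ⟨Cat.of P, Dia.finitePoset P⟩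

variable {P Q R : Type w} [PartialOrder P] [Finite P] [PartialOrder Q] [Finite Q]
  [PartialOrder R] [Finite R]

/-- The functor between finite posets given by a monotone map. -/
def posetMap (f : P →o Q) : Dia.poset P ⥤ Dia.poset Q :=
  show P ⥤ Q from f.monotone.functor

theorem posetMap_id : Dia.posetMap (OrderHom.id : P →o P) = 𝟭 _ := rfl

theorem posetMap_comp (f : P →o Q) (g : Q →o R) :
    Dia.posetMap (g.comp f) = Dia.posetMap f ⋙ Dia.posetMap g := rfl

/-- The final category `e`. -/
def pt : Dia.Shape := Dia.poset PUnit.{w + 1}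

/-- The empty category. -/
def empty : Dia.Shape := Dia.poset PEmpty.{w + 1}

variable {Dia}

/-- The functor `i_{X,x} : e ⥤ X` with value `x`. -/
def ptTo {X : Dia.Shape} (x : X) : Dia.pt ⥤ X := (Functor.const _).obj x

/-- The coproduct `X ⊔ Y`. -/
def sum (X Y : Dia.Shape) : Dia.Shape :=
  ⟨Cat.of (X ⊕ Y), Dia.coproduct _ _ X.mem Y.mem⟩

/-- The inclusion of the first factor of a coproduct. -/
def inl (X Y : Dia.Shape) : X ⥤ sum X Y := Sum.inl_ X Y

/-- The inclusion of the second factor of a coproduct. -/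
def inr (X Y : Dia.Shape) : Y ⥤ sum X Y := Sum.inr_ X Y

/-- The comma category `f ↓ y`, with objects the pairs `(x, f x ⟶ y)`. -/
def slice {X Y : Dia.Shape} (f : X ⥤ Y) (y : Y) : Dia.Shape :=
  ⟨Cat.of (Comma f (ptTo y)), Dia.comma _ _ _ _ _ X.mem Dia.pt.mem Y.mem⟩

/-- The source functor `j_{f,y} : f ↓ y ⥤ X`. -/
def sliceSource {X Y : Dia.Shape} (f : X ⥤ Y) (y : Y) : slice f y ⥤ X :=
  Comma.fst f (ptTo y)

/-- The functor `p_{f ↓ y} : f ↓ y ⥤ e`. -/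
def sliceToPt {X Y : Dia.Shape} (f : X ⥤ Y) (y : Y) : slice f y ⥤ Dia.pt :=
  Comma.snd f (ptTo y)

/-- The transformation `α_{f,y} : f j_{f,y} ⟶ i_{Y,y} p_{f ↓ y}`, whose component at
`(x, f x ⟶ y)` is `f x ⟶ y`. -/
def sliceNatTrans {X Y : Dia.Shape} (f : X ⥤ Y) (y : Y) :
    sliceSource f y ⋙ f ⟶ sliceToPt f y ⋙ ptTo y :=
  Comma.natTrans f (ptTo y)

end DiagramCategory

open DiagramCategory

/-! ### Prederivators -/

/-- A prederivator with domain `Dia`: a strict 2-functor from `Dia` to categories, contravariant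
on functors and covariant on natural transformations. -/
structure Prederivator (Dia : DiagramCategory.{w}) where
  obj : Dia.Shape → Cat.{v, u}
  /-- the inverse image functor `f^*` -/
  map : ∀ {X Y : Dia.Shape}, (X ⥤ Y) → (obj Y ⥤ obj X)
  /-- the transformation `α^* : f^* ⟶ g^*` -/
  map₂ : ∀ {X Y : Dia.Shape} {f g : X ⥤ Y}, (f ⟶ g) → (map f ⟶ map g)
  map_id : ∀ X : Dia.Shape, map (𝟭 X) = 𝟭 (obj X)
  map_comp : ∀ {X Y Z : Dia.Shape} (f : X ⥤ Y) (g : Y ⥤ Z), map (f ⋙ g) = map g ⋙ map f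
  map₂_id : ∀ {X Y : Dia.Shape} (f : X ⥤ Y), map₂ (𝟙 f) = 𝟙 (map f)
  map₂_comp : ∀ {X Y : Dia.Shape} {f g h : X ⥤ Y} (α : f ⟶ g) (β : g ⟶ h),
    map₂ (α ≫ β) = map₂ α ≫ map₂ β
  map₂_whiskerLeft : ∀ {X Y Z : Dia.Shape} (f : X ⥤ Y) {g h : Y ⥤ Z} (α : g ⟶ h),
    map₂ (Functor.whiskerLeft f α) =
      eqToHom (map_comp f g) ≫ Functor.whiskerRight (map₂ α) (map f) ≫
        eqToHom (map_comp f h).symm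
  map₂_whiskerRight : ∀ {X Y Z : Dia.Shape} {f g : X ⥤ Y} (α : f ⟶ g) (h : Y ⥤ Z),
    map₂ (Functor.whiskerRight α h) =
      eqToHom (map_comp f h) ≫ Functor.whiskerLeft (map h) (map₂ α) ≫
        eqToHom (map_comp g h).symm

namespace Prederivator

variable {Dia : DiagramCategory.{w}}

/-- A strict morphism of prederivators: functors commuting strictly with all inverse image
functors and compatible with the transformations `α^*`. -/
structure StrictHom (D D' : Prederivator.{w, v, u} Dia) where
  app : ∀ X : Dia.Shape, D.obj X ⥤ D'.obj X
  comm : ∀ {X Y : Dia.Shape} (f : X ⥤ Y), D.map f ⋙ app X = app Y ⋙ D'.map f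
  comm₂ : ∀ {X Y : Dia.Shape} {f g : X ⥤ Y} (α : f ⟶ g),
    Functor.whiskerRight (D.map₂ α) (app X) ≫ eqToHom (comm g) =
      eqToHom (comm f) ≫ Functor.whiskerLeft (app Y) (D'.map₂ α)

/-- A strict morphism of prederivators is an equivalence if all its components are equivalences
of categories. -/
def StrictHom.IsEquivalence {D D' : Prederivator.{w, v, u} Dia} (φ : StrictHom D D') : Prop :=
  ∀ X : Dia.Shape, (φ.app X).IsEquivalence

variable (D : Prederivator.{w, v, u} Dia)

/-- A prederivator is pointed if all its values have zero objects and all inverse image functors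
preserve zero objects. -/
class IsPointed : Prop where
  hasZeroObject : ∀ X : Dia.Shape, Limits.HasZeroObject (D.obj X)
  isZero_map : ∀ {X Y : Dia.Shape} (f : X ⥤ Y) (Z : D.obj Y),
    Limits.IsZero Z → Limits.IsZero ((D.map f).obj Z)

/-- All inverse image functors have left adjoints. -/
class HasLeftKan : Prop where
  isRightAdjoint : ∀ {X Y : Dia.Shape} (f : X ⥤ Y), (D.map f).IsRightAdjoint

instance [D.HasLeftKan] {X Y : Dia.Shape} (f : X ⥤ Y) : (D.map f).IsRightAdjoint :=
  HasLeftKan.isRightAdjoint f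

/-- A left adjoint `f_!` of `f^*`. -/
noncomputable def lan [D.HasLeftKan] {X Y : Dia.Shape} (f : X ⥤ Y) : D.obj X ⥤ D.obj Y :=
  (D.map f).leftAdjoint

/-- The adjunction `f_! ⊣ f^*`. -/
noncomputable def lanAdj [D.HasLeftKan] {X Y : Dia.Shape} (f : X ⥤ Y) : D.lan f ⊣ D.map f :=
  Adjunction.ofIsRightAdjoint (D.map f)

/-- The square `j^* f^* = (f j)^* ⟶ (i p)^* = p^* i^*` obtained by applying `D` to the comma
square of `f` and `y`. -/
def sliceSquare {X Y : Dia.Shape} (f : X ⥤ Y) (y : Y) :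
    TwoSquare (D.map f) (D.map (ptTo y)) (D.map (sliceSource f y)) (D.map (sliceToPt f y)) :=
  TwoSquare.mk _ _ _ _
    (eqToHom (D.map_comp (sliceSource f y) f).symm ≫ D.map₂ (sliceNatTrans f y) ≫
      eqToHom (D.map_comp (sliceToPt f y) (ptTo y)))

/-- The mate `c_{f,y} : p_! j^* ⟶ i_{Y,y}^* f_!` of the square above. -/
noncomputable def sliceMate [D.HasLeftKan] {X Y : Dia.Shape} (f : X ⥤ Y) (y : Y) :
    D.map (sliceSource f y) ⋙ D.lan (sliceToPt f y) ⟶ D.lan f ⋙ D.map (ptTo y) :=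
  ((mateEquiv (D.lanAdj f) (D.lanAdj (sliceToPt f y))).symm (D.sliceSquare f y)).natTrans

/-- A prederivator is a right derivator if it satisfies the axioms (Der1)-(Der4). -/
class IsRightDerivator : Prop extends HasLeftKan D where
  der1_sum : ∀ X Y : Dia.Shape,
    (Functor.prod' (D.map (inl X Y)) (D.map (inr X Y))).IsEquivalence
  der1_empty : Nonempty (D.obj Dia.empty ≌ Discrete PUnit.{1})
  der2 : ∀ {X : Dia.Shape} {F G : D.obj X} (g : F ⟶ G),
    (∀ x : X, IsIso ((D.map (ptTo x)).map g)) → IsIso g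
  der4 : ∀ {X Y : Dia.Shape} (f : X ⥤ Y) (y : Y), IsIso (D.sliceMate f y)

end Prederivator

open Prederivator

/-- A pointed right derivator with domain `Dia`. -/
structure PointedRightDerivator (Dia : DiagramCategory.{w}) extends
    Prederivator.{w, v, u} Dia where
  [isPointed : toPrederivator.IsPointed]
  [isRightDerivator : toPrederivator.IsRightDerivator]

attribute [instance] PointedRightDerivator.isPointed PointedRightDerivator.isRightDerivator

namespace Prederivator.StrictHom

variable {Dia : DiagramCategory.{w}} {D D' : Prederivator.{w, v, u} Dia}

/-- The canonical transformation `f_! φ(X) ⟶ φ(Y) f_!`, the mate of `φ(X) f^* = f^* φ(Y)`. -/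
noncomputable def lanComparison [D.HasLeftKan] [D'.HasLeftKan] (φ : StrictHom D D')
    {X Y : Dia.Shape} (f : X ⥤ Y) : φ.app X ⋙ D'.lan f ⟶ D.lan f ⋙ φ.app Y :=
  ((mateEquiv (D.lanAdj f) (D'.lanAdj f)).symm
    (TwoSquare.mk _ _ _ _ (eqToHom (φ.comm f)))).natTrans

/-- A strict morphism is cocontinuous if it commutes with all the functors `f_!`. -/
def IsCocontinuous [D.HasLeftKan] [D'.HasLeftKan] (φ : StrictHom D D') : Prop :=
  ∀ {X Y : Dia.Shape} (f : X ⥤ Y), IsIso (φ.lanComparison f)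

theorem map_obj (φ : StrictHom D D') {X Y : Dia.Shape} (f : X ⥤ Y) (F : D.obj Y) :
    (φ.app X).obj ((D.map f).obj F) = (D'.map f).obj ((φ.app Y).obj F) :=
  Functor.congr_obj (φ.comm f) F

end Prederivator.StrictHom

/-- The 1-morphisms of pointed right derivators: cocontinuous strict morphisms. -/
structure CocontinuousStrictHom {Dia : DiagramCategory.{w}}
    (D D' : PointedRightDerivator.{w, v, u} Dia) extends
    StrictHom D.toPrederivator D'.toPrederivator where
  isCocontinuous : toStrictHom.IsCocontinuous

/-! ### The category of arrows of `[n]`, and squares -/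

/-- The poset of arrows `i → j` (that is, `i ≤ j`) of the poset `[n]`. -/
abbrev ArrowPoset (n : SimplexCategory) : Type w :=
  ULift.{w} {p : Fin (n.len + 1) × Fin (n.len + 1) // p.1 ≤ p.2}

/-- The arrow `i → j`. -/
def ArrowPoset.mk {n : SimplexCategory} (i j : Fin (n.len + 1)) (h : i ≤ j) :
    ArrowPoset.{w} n := ⟨⟨(i, j), h⟩⟩

/-- The map on arrows induced by a monotone map. -/
def ArrowPoset.map {m n : SimplexCategory} (θ : m ⟶ n) : ArrowPoset.{w} m →o ArrowPoset.{w} n where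
  toFun a := ArrowPoset.mk (θ.toOrderHom a.down.1.1) (θ.toOrderHom a.down.1.2)
    (θ.toOrderHom.monotone a.down.2)
  monotone' _ _ h := ⟨θ.toOrderHom.monotone h.1, θ.toOrderHom.monotone h.2⟩

/-- The poset `[1] × [1]`. -/
abbrev SquarePoset : Type w := ULift.{w} (Fin 2 × Fin 2)

/-- The poset `⌜`, that is, `[1] × [1]` without `(1,1)`. -/
abbrev CornerPoset : Type w := ULift.{w} {p : Fin 2 × Fin 2 // p ≠ (1, 1)}

/-- The inclusion `⌜ ⊆ [1] × [1]`. -/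
def CornerPoset.incl : CornerPoset.{w} →o SquarePoset.{w} where
  toFun a := ⟨a.down.1⟩
  monotone' _ _ h := h

/-- For `i ≤ j ≤ k` the square in `Ar[n]` with `(0,0) ↦ (i → j)`, `(1,0) ↦ (i → k)`,
`(0,1) ↦ (j → j)`, `(1,1) ↦ (j → k)`. -/
def ArrowPoset.square {n : SimplexCategory} (i j k : Fin (n.len + 1)) (hij : i ≤ j) (hjk : j ≤ k) :
    SquarePoset.{w} →o ArrowPoset.{w} n where
  toFun a := ArrowPoset.mk (if a.down.2 = 0 then i else j) (if a.down.1 = 0 then j else k) (by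
    split_ifs
    exacts [hij, hij.trans hjk, le_rfl, hjk])
  monotone' := by
    rintro ⟨a, b⟩ ⟨c, d⟩ ⟨h₁, h₂⟩
    dsimp only at h₁ h₂
    refine ⟨?_, ?_⟩
    · change (if b = 0 then i else j) ≤ (if d = 0 then i else j)
      split_ifs with hb hd
      exacts [le_rfl, hij, absurd (by subst_vars; exact le_antisymm h₂ (Fin.zero_le _)) hb, le_rfl]
    · change (if a = 0 then j else k) ≤ (if c = 0 then j else k)
      split_ifs with ha hc
      exacts [le_rfl, hjk, absurd (by subst_vars; exact le_antisymm h₁ (Fin.zero_le _)) ha, le_rfl]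

theorem ArrowPoset.map_comp_square {m n : SimplexCategory} (θ : m ⟶ n) (i j k : Fin (m.len + 1))
    (hij : i ≤ j) (hjk : j ≤ k) :
    (ArrowPoset.map.{w} θ).comp (ArrowPoset.square i j k hij hjk) =
      ArrowPoset.square (θ.toOrderHom i) (θ.toOrderHom j) (θ.toOrderHom k)
        (θ.toOrderHom.monotone hij) (θ.toOrderHom.monotone hjk) := by
  refine OrderHom.ext _ _ (funext fun a => ?_)
  apply ULift.ext
  apply Subtype.ext
  refine Prod.ext ?_ ?_
  · exact apply_ite θ.toOrderHom (a.down.2 = 0) i j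
  · exact apply_ite θ.toOrderHom (a.down.1 = 0) j k

namespace DiagramCategory

variable (Dia : DiagramCategory.{w})

/-- `Ar[n]` as an object of `Dia`. -/
abbrev Ar (n : SimplexCategory) : Dia.Shape := Dia.poset (ArrowPoset.{w} n)

/-- `□ = [1] × [1]` as an object of `Dia`. -/
abbrev Sq : Dia.Shape := Dia.poset SquarePoset.{w}

/-- `⌜` as an object of `Dia`. -/
abbrev Corner : Dia.Shape := Dia.poset CornerPoset.{w}

/-- The inclusion functor `⌜ ⥤ □`. -/
abbrev cornerIncl : Dia.Corner ⥤ Dia.Sq := Dia.posetMap CornerPoset.incl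

/-- The functor `Ar[m] ⥤ Ar[n]` induced by `[m] ⟶ [n]`. -/
abbrev arMap {m n : SimplexCategory} (θ : m ⟶ n) : Dia.Ar m ⥤ Dia.Ar n :=
  Dia.posetMap (ArrowPoset.map θ)

/-- The square in `Ar[n]` attached to `i ≤ j ≤ k`, as a functor. -/
abbrev arSquare {n : SimplexCategory} (i j k : Fin (n.len + 1)) (hij : i ≤ j) (hjk : j ≤ k) :
    Dia.Sq ⥤ Dia.Ar n :=
  Dia.posetMap (ArrowPoset.square i j k hij hjk)

/-- The functor `e ⥤ Ar[n]` given by `i → i`. -/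
abbrev arDiag {n : SimplexCategory} (i : Fin (n.len + 1)) : Dia.pt ⥤ Dia.Ar n :=
  ptTo (X := Dia.Ar n) (ArrowPoset.mk.{w} i i le_rfl)

theorem arDiag_comp_arMap {m n : SimplexCategory} (θ : m ⟶ n) (i : Fin (m.len + 1)) :
    Dia.arDiag i ⋙ Dia.arMap θ = Dia.arDiag (θ.toOrderHom i) := rfl

theorem arSquare_comp_arMap {m n : SimplexCategory} (θ : m ⟶ n) (i j k : Fin (m.len + 1))
    (hij : i ≤ j) (hjk : j ≤ k) :
    Dia.arSquare i j k hij hjk ⋙ Dia.arMap θ =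
      Dia.arSquare (θ.toOrderHom i) (θ.toOrderHom j) (θ.toOrderHom k)
        (θ.toOrderHom.monotone hij) (θ.toOrderHom.monotone hjk) := by
  rw [arSquare, arMap, ← posetMap_comp, ArrowPoset.map_comp_square]

end DiagramCategory

/-! ### The `S`-construction -/

namespace Prederivator

variable {Dia : DiagramCategory.{w}}

/-- A commutative square `F` in `D` is cocartesian if the counit `i_! i^* F ⟶ F` is an
isomorphism, for `i` the inclusion `⌜ ⥤ □`. -/
def IsCocartesian (D : Prederivator.{w, v, u} Dia) [D.HasLeftKan] (F : D.obj Dia.Sq) : Prop :=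
  IsIso ((D.lanAdj Dia.cornerIncl).counit.app F)

/-- The objects of `D(Ar[n])` that belong to `S_n D`. -/
structure IsSObject (D : Prederivator.{w, v, u} Dia) [D.HasLeftKan] (n : SimplexCategory)
    (F : D.obj (Dia.Ar n)) : Prop where
  isZero : ∀ i : Fin (n.len + 1), Limits.IsZero ((D.map (Dia.arDiag i)).obj F)
  isCocartesian : ∀ (i j k : Fin (n.len + 1)) (hij : i ≤ j) (hjk : j ≤ k),
    D.IsCocartesian ((D.map (Dia.arSquare i j k hij hjk)).obj F)

theorem IsSObject.map {D : Prederivator.{w, v, u} Dia} [D.HasLeftKan] {m n : SimplexCategory}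
    (θ : m ⟶ n) {F : D.obj (Dia.Ar n)} (hF : D.IsSObject n F) :
    D.IsSObject m ((D.map (Dia.arMap θ)).obj F) where
  isZero i := by
    have h := hF.isZero (θ.toOrderHom i)
    rwa [← arDiag_comp_arMap, D.map_comp] at h
  isCocartesian i j k hij hjk := by
    have h := hF.isCocartesian (θ.toOrderHom i) (θ.toOrderHom j) (θ.toOrderHom k)
      (θ.toOrderHom.monotone hij) (θ.toOrderHom.monotone hjk)
    rwa [← arSquare_comp_arMap, D.map_comp] at h

variable (D : Prederivator.{w, v, u} Dia) [D.HasLeftKan]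

/-- `S_n D`, the full subcategory of `D(Ar[n])` on the objects above. -/
abbrev S (n : SimplexCategory) : Type u := ObjectProperty.FullSubcategory (D.IsSObject n)

/-- The simplicial operator `S_n D ⥤ S_m D` of `θ : [m] ⟶ [n]`. -/
abbrev sMap {m n : SimplexCategory} (θ : m ⟶ n) : D.S n ⥤ D.S m :=
  ObjectProperty.lift (D.IsSObject m) (ObjectProperty.ι (D.IsSObject n) ⋙ D.map (Dia.arMap θ))
    (fun F => F.property.map θ)

end Prederivator

/-- Functors into a full subcategory that agree in the ambient category are equal. -/
theorem functor_ext_of_comp_ι {C E : Type*} [Category C] [Category E] {P : ObjectProperty E}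
    {F G : C ⥤ P.FullSubcategory} (h : F ⋙ P.ι = G ⋙ P.ι) : F = G := by
  have hobj : ∀ X, F.obj X = G.obj X := fun X =>
    ObjectProperty.FullSubcategory.ext (Functor.congr_obj h X)
  refine CategoryTheory.Functor.ext hobj fun X Y f => P.ι.map_injective ?_
  have := Functor.congr_hom h f
  simpa [eqToHom_map] using this

/-- The simplicial category `S_• D`. -/
def Prederivator.sConstruction {Dia : DiagramCategory.{w}} (D : Prederivator.{w, v, u} Dia)
    [D.HasLeftKan] : SimplexCategoryᵒᵖ ⥤ Cat.{v, u} where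
  obj n := Cat.of (D.S n.unop)
  map θ := (D.sMap θ.unop).toCatHom
  map_id n := by
    apply Cat.ext
    apply functor_ext_of_comp_ι
    change ObjectProperty.ι _ ⋙ D.map (𝟭 _) = _
    rw [D.map_id]
    rfl
  map_comp {a b c} θ ψ := by
    apply Cat.ext
    apply functor_ext_of_comp_ι
    change ObjectProperty.ι _ ⋙ D.map (Dia.arMap ψ.unop ⋙ Dia.arMap θ.unop) = _
    rw [D.map_comp]
    rfl

namespace CocontinuousStrictHom

variable {Dia : DiagramCategory.{w}} {D D' : PointedRightDerivator.{w, v, u} Dia}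
  (φ : CocontinuousStrictHom D D')

/-- Components at `e` preserve zero objects: a zero object is `f_!` of the object of `D(∅)`, where
`f : ∅ ⥤ e`. -/
theorem isZero_app {Z : D.obj Dia.pt} (hZ : Limits.IsZero Z) :
    Limits.IsZero ((φ.app Dia.pt).obj Z) := by
  let f : Dia.empty ⥤ Dia.pt := Dia.posetMap ⟨fun _ => PUnit.unit, fun _ _ _ => le_rfl⟩
  have key : ∀ (E : PointedRightDerivator.{w, v, u} Dia) (A : E.obj Dia.empty),
      Limits.IsZero ((E.lan f).obj A) := by
    intro E A
    obtain ⟨e⟩ := E.isRightDerivator.der1_empty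
    have hh : ∀ B : E.obj Dia.pt, Nonempty (Unique ((E.lan f).obj A ⟶ B)) := fun B =>
      haveI : Unique (e.functor.obj A ⟶ e.functor.obj ((E.map f).obj B)) :=
        ⟨⟨eqToHom (Subsingleton.elim _ _)⟩, fun _ => Subsingleton.elim _ _⟩
      ⟨(((E.lanAdj f).homEquiv A B).trans e.fullyFaithfulFunctor.homEquiv).unique⟩
    have := E.isPointed.hasZeroObject Dia.pt
    have hi : Limits.IsInitial ((E.lan f).obj A) :=
      Limits.IsInitial.ofUniqueHom (fun B => (hh B).some.default) (fun B m => (hh B).some.uniq m)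
    exact (Limits.isZero_zero (E.obj Dia.pt)).of_iso
      (hi.uniqueUpToIso (Limits.HasZeroObject.zeroIsInitial))
  obtain ⟨e⟩ := D.isRightDerivator.der1_empty
  let A : D.obj Dia.empty := e.inverse.obj ⟨PUnit.unit⟩
  have := φ.isCocontinuous f
  exact (key D' ((φ.app _).obj A)).of_iso
    (((φ.app _).mapIso (hZ.iso (key D A))).trans
      (asIso ((φ.toStrictHom.lanComparison f).app A)).symm)

/-- Cocartesian squares are preserved. -/
theorem isCocartesian_app {F : D.obj Dia.Sq} (hF : D.IsCocartesian F) :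
    D'.IsCocartesian ((φ.app Dia.Sq).obj F) := by
  have h := mateEquiv_counit_symm (D.lanAdj Dia.cornerIncl) (D'.lanAdj Dia.cornerIncl)
    (TwoSquare.mk _ _ _ _ (eqToHom (φ.comm Dia.cornerIncl))) F
  have := φ.isCocontinuous Dia.cornerIncl
  have : IsIso ((D.lanAdj Dia.cornerIncl).counit.app F) := hF
  have h₁ : IsIso ((φ.toStrictHom.lanComparison Dia.cornerIncl).app
      ((D.map Dia.cornerIncl).obj F)) := inferInstance
  have h₂ : IsIso ((D'.lan Dia.cornerIncl).map ((eqToHom (φ.comm Dia.cornerIncl)).app F)) :=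
    inferInstance
  change (D'.lan Dia.cornerIncl).map ((eqToHom (φ.comm Dia.cornerIncl)).app F) ≫ _ =
    (φ.toStrictHom.lanComparison Dia.cornerIncl).app _ ≫ _ at h
  have h₃ : IsIso ((D'.lan Dia.cornerIncl).map ((eqToHom (φ.comm Dia.cornerIncl)).app F) ≫
      (D'.lanAdj Dia.cornerIncl).counit.app ((φ.app Dia.Sq).obj F)) := by
    rw [h]
    infer_instance
  exact IsIso.of_isIso_comp_left
    ((D'.lan Dia.cornerIncl).map ((eqToHom (φ.comm Dia.cornerIncl)).app F)) _

theorem isSObject_app {n : SimplexCategory} {F : D.obj (Dia.Ar n)} (hF : D.IsSObject n F) :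
    D'.IsSObject n ((φ.app (Dia.Ar n)).obj F) where
  isZero i := by
    rw [← φ.map_obj]
    exact φ.isZero_app (hF.isZero i)
  isCocartesian i j k hij hjk := by
    rw [← φ.map_obj]
    exact φ.isCocartesian_app (hF.isCocartesian i j k hij hjk)

/-- The functor `S_n D ⥤ S_n D'` induced by `φ`. -/
abbrev sApp (n : SimplexCategory) : D.S n ⥤ D'.S n :=
  ObjectProperty.lift (D'.IsSObject n) (ObjectProperty.ι (D.IsSObject n) ⋙ φ.app (Dia.Ar n))
    (fun F => φ.isSObject_app F.property)

/-- The map of simplicial categories `S_• D ⟶ S_• D'` induced by `φ`. -/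
def sConstructionMap : D.sConstruction ⟶ D'.sConstruction where
  app n := (φ.sApp n.unop).toCatHom
  naturality m n θ := by
    apply Cat.ext
    apply functor_ext_of_comp_ι
    change ObjectProperty.ι _ ⋙ D.map (Dia.arMap θ.unop) ⋙ φ.app _ =
      ObjectProperty.ι _ ⋙ φ.app _ ⋙ D'.map (Dia.arMap θ.unop)
    rw [φ.comm]

end CocontinuousStrictHom

/-! ### Realization of simplicial categories, loop spaces, weak equivalences -/

/-- The simplicial set `N iso C` of a category `C`: its `m`-simplices are the chains of `m`
composable isomorphisms. -/
def isoNerve : Cat.{v, u} ⥤ SSet.{max u v} where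
  obj C := nerve (Core C)
  map F := nerveMap F.toFunctor.core

/-- The diagonal of a bisimplicial set. -/
def bisimplicialDiag : (SimplexCategoryᵒᵖ ⥤ SSet.{u}) ⥤ SSet.{u} where
  obj X := Functor.diag SimplexCategoryᵒᵖ ⋙ Functor.uncurry.obj X
  map f := Functor.whiskerLeft (Functor.diag SimplexCategoryᵒᵖ) (Functor.uncurry.map f)

/-- The simplicial set `diag N_• iso C_•` of a simplicial category `C_•`. -/
def diagIsoNerve : (SimplexCategoryᵒᵖ ⥤ Cat.{v, u}) ⥤ SSet.{max u v} :=
  (Functor.whiskeringRight _ _ _).obj isoNerve ⋙ bisimplicialDiag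

/-- The vertex of `diag N_• iso C_•` given by an object of `C_0`. -/
def diagIsoNerveVertex (C : SimplexCategoryᵒᵖ ⥤ Cat.{v, u})
    (z : C.obj (Opposite.op (SimplexCategory.mk 0))) :
    (diagIsoNerve.obj C).obj (Opposite.op (SimplexCategory.mk 0)) :=
  show ComposableArrows (Core (C.obj (Opposite.op (SimplexCategory.mk 0)))) 0 from
    ComposableArrows.mk₀ ⟨z⟩

/-- The point of the geometric realization given by a vertex of a simplicial set. -/
noncomputable def realizationPoint (X : SSet.{u}) (x : X.obj (Opposite.op (SimplexCategory.mk 0))) :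
    SSet.toTop.obj X :=
  TopCat.toSSetObj₀Equiv ((sSetTopAdj.unit.app X).app _ x)

theorem realizationPoint_map {X Y : SSet.{u}} (f : X ⟶ Y)
    (x : X.obj (Opposite.op (SimplexCategory.mk 0))) :
    (SSet.toTop.map f).hom (realizationPoint X x) = realizationPoint Y (f.app _ x) := by
  have h := congr_arg (fun k => k.app (Opposite.op (SimplexCategory.mk 0)) x)
    (sSetTopAdj.unit.naturality f)
  exact (congr_arg TopCat.toSSetObj₀Equiv h).symm

open scoped Topology.Homotopy Topology in
/-- The map of loop spaces induced by a based continuous map. -/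
def loopSpaceMap {X Y : Type*} [TopologicalSpace X] [TopologicalSpace Y] (f : C(X, Y)) {x : X}
    {y : Y} (h : f x = y) : C(Ω X x, Ω Y y) where
  toFun γ := (γ.map f.continuous).cast h.symm h.symm
  continuous_toFun := by
    rw [continuous_induced_rng]
    exact (ContinuousMap.continuous_postcomp f).comp continuous_induced_dom

open scoped Topology.Homotopy Topology in
/-- The map on homotopy groups induced by a continuous map. -/
def homotopyGroupMap (n : ℕ) {X Y : Type*} [TopologicalSpace X] [TopologicalSpace Y] (f : C(X, Y))
    (x : X) : π_ n X x → π_ n Y (f x) :=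
  Quotient.map (fun γ => (⟨f.comp γ.1, fun t ht => congr_arg f (γ.2 t ht)⟩ : Ω^ (Fin n) Y (f x)))
    (fun _ _ h => h.comp_continuousMap f)

/-- The map on path components induced by a continuous map. -/
def zerothHomotopyMap {X Y : Type*} [TopologicalSpace X] [TopologicalSpace Y] (f : C(X, Y)) :
    ZerothHomotopy X → ZerothHomotopy Y :=
  ZerothHomotopy.lift (fun x => ZerothHomotopy.mk (f x))
    (fun _ _ p => ZerothHomotopy.sound (p.map f.continuous))

/-- A continuous map is a weak (homotopy) equivalence if it induces a bijection on path components
and on all homotopy groups at all base points. -/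
def IsWeakHomotopyEquivalence {X Y : Type*} [TopologicalSpace X] [TopologicalSpace Y]
    (f : C(X, Y)) : Prop :=
  Function.Bijective (zerothHomotopyMap f) ∧
    ∀ (n : ℕ) (x : X), Function.Bijective (homotopyGroupMap (n + 1) f x)

/-! ### Derivator `K`-theory -/

namespace PointedRightDerivator

variable {Dia : DiagramCategory.{w}} (D : PointedRightDerivator.{w, v, u} Dia)

/-- The space `|N_• iso S_• D|`. -/
noncomputable def deloopedK : TopCat.{max u v} :=
  SSet.toTop.obj (diagIsoNerve.obj D.sConstruction)

/-- The base point of `|N_• iso S_• D|` given by an object of `S_0 D`, that is, by a zero object of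
`D(Ar[0])`. -/
noncomputable def basepoint (z : D.S (SimplexCategory.mk 0)) : D.deloopedK :=
  realizationPoint _ (diagIsoNerveVertex D.sConstruction z)

open scoped Topology.Homotopy in
/-- The derivator `K`-theory space `K(D) = Ω |N_• iso S_• D|`, where the loops are based at an
object of `S_0 D`. -/
abbrev K (z : D.S (SimplexCategory.mk 0)) : Type (max u v) :=
  Ω D.deloopedK (D.basepoint z)

end PointedRightDerivator

namespace CocontinuousStrictHom

variable {Dia : DiagramCategory.{w}} {D D' : PointedRightDerivator.{w, v, u} Dia}
  (φ : CocontinuousStrictHom D D')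

/-- The map `|N_• iso S_• D| ⟶ |N_• iso S_• D'|` induced by `φ`. -/
noncomputable def deloopedKMap : D.deloopedK ⟶ D'.deloopedK :=
  SSet.toTop.map (diagIsoNerve.map φ.sConstructionMap)

theorem deloopedKMap_basepoint (z : D.S (SimplexCategory.mk 0)) :
    φ.deloopedKMap.hom (D.basepoint z) = D'.basepoint ((φ.sApp _).obj z) := by
  refine (realizationPoint_map _ _).trans (congr_arg (realizationPoint _) ?_)
  exact ComposableArrows.ext₀ rfl

/-- The map `K(φ) : K(D) → K(D')`. -/
noncomputable def KMap (z : D.S (SimplexCategory.mk 0)) :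
    C(D.K z, D'.K ((φ.sApp _).obj z)) :=
  loopSpaceMap φ.deloopedKMap.hom (φ.deloopedKMap_basepoint z)

end CocontinuousStrictHom

/-! For an equivalence `φ`, the canonical map `f_! φ ⟶ φ f_!` is the mate of an identity along two
equivalences, hence invertible (`mateEquiv_symm_isIso_app`). So `φ` preserves zero objects and
cocartesian squares; being fully faithful it also reflects them, and every `φ.sApp n` is an
equivalence of categories. It remains to see that a levelwise equivalence of simplicial categories
realizes to a weak equivalence, and that this survives looping.

Weak equivalences are handled through `HasRelativeCubeLifting`. This property is stable under
composition, passes to loop spaces by currying, and yields bijections on path components and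
homotopy groups. It holds for the realization of an anodyne extension and of any retraction of one.
The input is that the singular set of `C(Iᵐ, T) → C(∂Iᵐ, T)` maps by a Kan fibration, so that maps
on `|A| × Iᵐ ∪ |B| × ∂Iᵐ` extend to `|B| × Iᵐ`.

A mapping cylinder factors a levelwise equivalence into the inclusion of the source followed by a
retraction of the inclusion of the target. Both inclusions are levelwise equivalences injective on
objects, so it suffices that such an inclusion induces an anodyne extension of diagonals
(`anodyneExtensions_diagIsoNerve_map`). In each simplicial degree, conjugation by chosen
isomorphisms deforms all chains of isomorphisms into those with objects in the image. The choices
need not be natural for face maps, but by the Eilenberg–Zilber lemma they can be made compatible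
with degeneracies. This is enough: filtering the diagonal by rows, each stage is a pushout of the
pushout-product of `∂Δ[m] ⊆ Δ[m]` with an anodyne inclusion of rows (`anodyneExtensions_diag`). -/

/-! ### Maps with the relative lifting property for cubes -/

section RelativeCubeLifting

open scoped unitInterval Topology.Homotopy

variable {X Y Z : Type*} [TopologicalSpace X] [TopologicalSpace Y] [TopologicalSpace Z]

/-- A continuous map `f : X → Y` has the relative cube lifting property if for all maps
`u : ∂Iⁿ → X` and `v : Iⁿ → Y` with `f u = v` on `∂Iⁿ`, there is an extension `w : Iⁿ → X` of `u`
such that `f w` is homotopic to `v` relative to `∂Iⁿ`. -/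
def HasRelativeCubeLifting (f : C(X, Y)) : Prop :=
  ∀ (n : ℕ) (u : C(Cube.boundary (Fin n), X)) (v : C(Fin n → I, Y)), (∀ p, f (u p) = v p) →
    ∃ w : C(Fin n → I, X), (∀ p : Cube.boundary (Fin n), w p = u p) ∧
      (f.comp w).HomotopicRel v (Cube.boundary (Fin n))

namespace HasRelativeCubeLifting

theorem comp {g : C(Y, Z)} {f : C(X, Y)} (hg : HasRelativeCubeLifting g)
    (hf : HasRelativeCubeLifting f) : HasRelativeCubeLifting (g.comp f) := by
  intro n u v huv
  obtain ⟨w, hw, hwv⟩ := hg n (f.comp u) v huv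
  obtain ⟨t, ht, htw⟩ := hf n u w fun p => (hw p).symm
  exact ⟨t, ht, (htw.comp_continuousMap g).trans hwv⟩

end HasRelativeCubeLifting

theorem Cube.isClosed_boundary (n : ℕ) : IsClosed (Cube.boundary (Fin n)) := by
  have : Cube.boundary (Fin n) = ⋃ i : Fin n, {y | y i = 0} ∪ {y | y i = 1} := by
    ext y
    simp [Cube.boundary]
  rw [this]
  exact isClosed_iUnion_of_finite fun i =>
    (isClosed_singleton.preimage (continuous_apply i)).union
      (isClosed_singleton.preimage (continuous_apply i))

theorem Cube.mem_boundary_succ {n : ℕ} {p : Fin (n + 1) → I} :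
    p ∈ Cube.boundary (Fin (n + 1)) ↔ (p 0 = 0 ∨ p 0 = 1) ∨ Fin.tail p ∈ Cube.boundary (Fin n) := by
  simp only [Cube.boundary, Set.mem_ofPred_eq, Fin.exists_fin_succ]
  rfl

theorem Cube.continuous_tail (n : ℕ) : Continuous (Fin.tail : (Fin (n + 1) → I) → (Fin n → I)) :=
  continuous_pi fun i => continuous_apply i.succ

/-- The point `1/2` of the unit interval. -/
noncomputable def unitInterval.mid : I := ⟨1 / 2, by norm_num, by norm_num⟩

/-- Given `γ₀` and `γ₁` agreeing on the boundary, the map on `∂(I × Iⁿ)` that is `γ₀` on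
`0 × Iⁿ` and `γ₁` on `1 × Iⁿ` is continuous. -/
theorem Cube.continuousOn_boundary_ite {n : ℕ} (γ₀ γ₁ : C(Fin n → I, X))
    (h : ∀ p ∈ Cube.boundary (Fin n), γ₀ p = γ₁ p) :
    ContinuousOn (fun p : Fin (n + 1) → I =>
      if p 0 ≤ unitInterval.mid then γ₀ (Fin.tail p) else γ₁ (Fin.tail p))
      (Cube.boundary (Fin (n + 1))) := by
  -- The cutoff value is immaterial: a boundary point with `p 0` strictly between `0` and `1` has
  -- its tail in `∂Iⁿ`, where `γ₀` and `γ₁` agree. Cutting at `1/2` gives two closed pieces.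
  have hc : Cube.boundary (Fin (n + 1)) =
      (Cube.boundary (Fin (n + 1)) ∩ {p | p 0 ≤ unitInterval.mid}) ∪
        (Cube.boundary (Fin (n + 1)) ∩ {p | unitInterval.mid ≤ p 0}) := by
    rw [← Set.inter_union_distrib_left]
    exact (Set.inter_eq_left.2 fun p _ => le_total (p 0) unitInterval.mid).symm
  rw [hc]
  refine ContinuousOn.union_of_isClosed ?_ ?_ ?_ ?_
  · exact (γ₀.continuous.comp (continuous_tail n)).continuousOn.congr fun p hp => if_pos hp.2
  · refine (γ₁.continuous.comp (continuous_tail n)).continuousOn.congr fun p hp => ?_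
    split_ifs with hm
    · have he : p 0 = unitInterval.mid := le_antisymm hm hp.2
      refine h _ ?_
      rcases Cube.mem_boundary_succ.1 hp.1 with (h0 | h1) | h2
      · exact absurd (he.symm.trans h0) fun h => by
          have := congr_arg Subtype.val h
          norm_num [unitInterval.mid] at this
      · exact absurd (he.symm.trans h1) fun h => by
          have := congr_arg Subtype.val h
          norm_num [unitInterval.mid] at this
      · exact h2
    · rfl
  · exact (isClosed_boundary _).inter (isClosed_le (continuous_apply 0) continuous_const)
  · exact (isClosed_boundary _).inter (isClosed_le continuous_const (continuous_apply 0))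

theorem unitInterval.zero_le_mid : (0 : I) ≤ mid := by
  change (0 : ℝ) ≤ 1 / 2
  norm_num

theorem unitInterval.not_one_le_mid : ¬ (1 : I) ≤ mid := by
  change ¬ (1 : ℝ) ≤ 1 / 2
  norm_num

namespace HasRelativeCubeLifting

variable {f : C(X, Y)}

/-- Maps with the relative cube lifting property detect relative homotopies. -/
theorem homotopicRel (hf : HasRelativeCubeLifting f) {n : ℕ} (γ₀ γ₁ : C(Fin n → I, X))
    (h : ∀ p ∈ Cube.boundary (Fin n), γ₀ p = γ₁ p)
    (H : (f.comp γ₀).HomotopicRel (f.comp γ₁) (Cube.boundary (Fin n))) :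
    γ₀.HomotopicRel γ₁ (Cube.boundary (Fin n)) := by
  obtain ⟨H⟩ := H
  let V : (Fin (n + 1) → I) → X := fun p =>
    if p 0 ≤ unitInterval.mid then γ₀ (Fin.tail p) else γ₁ (Fin.tail p)
  have hV₀ : ∀ p, p 0 = 0 → V p = γ₀ (Fin.tail p) := fun p hp =>
    if_pos (by rw [hp]; exact unitInterval.zero_le_mid)
  have hV₁ : ∀ p, p 0 = 1 → V p = γ₁ (Fin.tail p) := fun p hp =>
    if_neg (by rw [hp]; exact unitInterval.not_one_le_mid)
  have hV : ∀ p : Fin (n + 1) → I, Fin.tail p ∈ Cube.boundary (Fin n) →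
      V p = γ₀ (Fin.tail p) := fun p hp => by
    dsimp only [V]
    rw [← h _ hp, ite_self]
  -- `V` and `H` pose a lifting problem one dimension higher. The extension `w` of `V` is already
  -- the desired homotopy, whatever its image in `Y`.
  obtain ⟨w, hw, -⟩ := hf (n + 1)
    ⟨_, (Cube.continuousOn_boundary_ite γ₀ γ₁ h).domRestrict⟩
    ⟨fun p : Fin (n + 1) → I => H (p 0, Fin.tail p),
      H.continuous.comp ((continuous_apply 0).prodMk (Cube.continuous_tail n))⟩
    (by
      rintro ⟨p, hp⟩
      change f (V p) = H (p 0, Fin.tail p)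
      rcases Cube.mem_boundary_succ.1 hp with (h0 | h1) | h2
      · rw [hV₀ p h0, h0, H.apply_zero]
        rfl
      · rw [hV₁ p h1, h1, H.apply_one]
        rfl
      · rw [H.eq_fst _ h2, hV p h2]
        rfl)
  have hw' : ∀ p ∈ Cube.boundary (Fin (n + 1)), w p = V p := fun p hp => hw ⟨p, hp⟩
  refine ⟨⟨⟨⟨fun p => w (Fin.cons p.1 p.2 : Fin (n + 1) → I), w.continuous.comp ?_⟩,
    fun p => ?_, fun p => ?_⟩, fun t p hp => ?_⟩⟩
  · refine continuous_pi fun i => ?_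
    refine Fin.cases ?_ (fun i => ?_) i
    · exact continuous_fst
    · exact (continuous_apply i).comp continuous_snd
  · change w (Fin.cons 0 p : Fin (n + 1) → I) = γ₀ p
    rw [hw' _ (Cube.mem_boundary_succ.2 (Or.inl (Or.inl rfl))), hV₀ _ rfl, Fin.tail_cons]
  · change w (Fin.cons 1 p : Fin (n + 1) → I) = γ₁ p
    rw [hw' _ (Cube.mem_boundary_succ.2 (Or.inl (Or.inr rfl))), hV₁ _ rfl, Fin.tail_cons]
  · change w (Fin.cons t p : Fin (n + 1) → I) = γ₀ p
    have hp' : Fin.tail (Fin.cons t p : Fin (n + 1) → I) ∈ Cube.boundary (Fin n) := by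
      rwa [Fin.tail_cons]
    rw [hw' _ (Cube.mem_boundary_succ.2 (Or.inr hp')), hV _ hp', Fin.tail_cons]

/-- Surjectivity is the lifting property itself, with empty boundary for path components and
constant boundary values for homotopy groups. Injectivity is `homotopicRel`, that is, lifting one
dimension higher. -/
theorem isWeakHomotopyEquivalence (hf : HasRelativeCubeLifting f) :
    IsWeakHomotopyEquivalence f := by
  refine ⟨⟨?_, ?_⟩, fun n x => ⟨?_, ?_⟩⟩
  · intro a b hab
    induction a with | mk a
    induction b with | mk b
    obtain ⟨p⟩ := Quotient.exact hab
    obtain ⟨H⟩ := hf.homotopicRel (n := 0) (.const _ a) (.const _ b)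
      (fun p ⟨i, _⟩ => i.elim0)
      ⟨⟨⟨⟨fun q => p q.1, p.continuous.comp continuous_fst⟩, fun _ => p.source, fun _ => p.target⟩,
        fun t q ⟨i, _⟩ => i.elim0⟩⟩
    exact ZerothHomotopy.sound
      (⟨⟨fun t => H (t, Fin.elim0), by fun_prop⟩, H.apply_zero _, H.apply_one _⟩ : Path a b)
  · intro b
    induction b with | mk b
    obtain ⟨w, -, ⟨H⟩⟩ := hf 0 ⟨fun p => (p.2.choose.elim0 : X),
      continuous_of_const fun p => p.2.choose.elim0⟩ (.const _ b) fun p => p.2.choose.elim0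
    exact ⟨ZerothHomotopy.mk (w Fin.elim0), ZerothHomotopy.sound
      (⟨⟨fun t => H (t, Fin.elim0), by fun_prop⟩, H.apply_zero _, H.apply_one _⟩ : Path _ b)⟩
  · intro a b hab
    induction a using Quotient.inductionOn with | _ a
    induction b using Quotient.inductionOn with | _ b
    exact Quotient.sound (hf.homotopicRel a.1 b.1 (fun p hp => (a.2 p hp).trans (b.2 p hp).symm)
      (Quotient.exact hab))
  · intro b
    induction b using Quotient.inductionOn with | _ b
    obtain ⟨w, hw, H⟩ := hf (n + 1) (.const _ x) b.1
      fun p => (b.2 p p.2).symm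
    exact ⟨Quotient.mk _ ⟨w, fun p hp => hw ⟨p, hp⟩⟩, Quotient.sound H⟩

/-- The relative cube lifting property passes to loop spaces. -/
theorem loopSpaceMap (hf : HasRelativeCubeLifting f) {x : X} {y : Y} (h : f x = y) :
    HasRelativeCubeLifting (loopSpaceMap f h) := by
  classical
  intro n u v huv
  have huv' : ∀ p t, f (u p t) = v p t := fun p t => congr_arg (fun γ : Path y y => γ t) (huv p)
  -- Curried, a map `Iⁿ → Ω X` is a map on `Iⁿ⁺¹` that sends the two faces `p 0 = 0` and `p 0 = 1`
  -- to `x`. On the boundary, the default value `x` is used only on these faces.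
  let U : (Fin (n + 1) → I) → X := fun p =>
    if hp : Fin.tail p ∈ Cube.boundary (Fin n) then u ⟨_, hp⟩ (p 0) else x
  have hU : ContinuousOn U (Cube.boundary (Fin (n + 1))) := by
    have hc : Cube.boundary (Fin (n + 1)) =
        ({p | p 0 = 0} ∪ {p | p 0 = 1}) ∪ Fin.tail ⁻¹' (Cube.boundary (Fin n)) := by
      ext p
      exact Cube.mem_boundary_succ
    rw [hc]
    refine ContinuousOn.union_of_isClosed ?_ ?_ ?_ ?_
    · refine (continuousOn_const (c := x)).congr fun p hp => ?_
      dsimp only [U]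
      split_ifs with hp'
      · rcases hp with hp | hp
        · exact (congr_arg _ hp).trans (Path.source _)
        · exact (congr_arg _ hp).trans (Path.target _)
      · rfl
    · rw [continuousOn_iff_continuous_domRestrict]
      have hg : Continuous fun q : (Fin.tail ⁻¹' (Cube.boundary (Fin n)) : Set (Fin (n + 1) → I)) =>
          (⟨Fin.tail q.1, q.2⟩ : Cube.boundary (Fin n)) :=
        ((Cube.continuous_tail n).comp continuous_subtype_val).subtype_mk _
      have := (Path.continuous_uncurry_iff.2 u.continuous).comp
        (hg.prodMk ((continuous_apply 0).comp continuous_subtype_val))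
      refine this.congr fun q => Eq.symm ?_
      exact dif_pos (show Fin.tail q.1 ∈ Cube.boundary (Fin n) from q.2)
    · exact (isClosed_singleton.preimage (continuous_apply 0)).union
        (isClosed_singleton.preimage (continuous_apply 0))
    · exact (Cube.isClosed_boundary n).preimage (Cube.continuous_tail n)
  have hcons : Continuous fun q : (Fin n → I) × I => (Fin.cons q.2 q.1 : Fin (n + 1) → I) := by
    refine continuous_pi fun i => ?_
    refine Fin.cases ?_ (fun i => ?_) i
    · exact continuous_snd
    · exact (continuous_apply i).comp continuous_fst
  obtain ⟨w, hw, ⟨H⟩⟩ := hf (n + 1) ⟨_, hU.domRestrict⟩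
    ⟨fun p : Fin (n + 1) → I => v (Fin.tail p) (p 0),
      (Path.continuous_uncurry_iff.2 v.continuous).comp
        ((Cube.continuous_tail n).prodMk (continuous_apply 0))⟩ (by
      rintro ⟨p, hp⟩
      change f (U p) = v (Fin.tail p) (p 0)
      dsimp only [U]
      split_ifs with hp'
      · exact huv' _ _
      · rcases (Cube.mem_boundary_succ.1 hp).resolve_right hp' with h0 | h1
        · rw [h0, Path.source, h]
        · rw [h1, Path.target, h])
  have hw0 : ∀ p, w (Fin.cons 0 p) = x ∧ w (Fin.cons 1 p) = x := fun p => by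
    constructor
    · refine (hw ⟨_, Cube.mem_boundary_succ.2 (Or.inl (Or.inl rfl))⟩).trans ?_
      change U _ = _
      dsimp only [U]
      split_ifs
      · exact Path.source _
      · rfl
    · refine (hw ⟨_, Cube.mem_boundary_succ.2 (Or.inl (Or.inr rfl))⟩).trans ?_
      change U _ = _
      dsimp only [U]
      split_ifs
      · exact Path.target _
      · rfl
  refine ⟨⟨fun p => ⟨⟨fun t => w (Fin.cons t p), ?_⟩, (hw0 p).1, (hw0 p).2⟩, ?_⟩, ?_, ?_⟩
  · exact w.continuous.comp (hcons.comp (continuous_const.prodMk continuous_id))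
  · exact Path.continuous_uncurry_iff.1 (w.continuous.comp hcons)
  · rintro ⟨p, hp⟩
    ext t
    have hp' : Fin.tail (Fin.cons t p : Fin (n + 1) → I) ∈ Cube.boundary (Fin n) := by
      rwa [Fin.tail_cons]
    refine (hw ⟨_, Cube.mem_boundary_succ.2 (Or.inr hp')⟩).trans ?_
    exact dif_pos hp'
  · have hH : ∀ s p, H (s, Fin.cons 0 p) = y ∧ H (s, Fin.cons 1 p) = y := fun s p => by
      constructor
      · refine (H.eq_fst s (Cube.mem_boundary_succ.2 (Or.inl (Or.inl rfl)))).trans ?_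
        exact (congr_arg f (hw0 p).1).trans h
      · refine (H.eq_fst s (Cube.mem_boundary_succ.2 (Or.inl (Or.inr rfl)))).trans ?_
        exact (congr_arg f (hw0 p).2).trans h
    have hHc : Continuous fun q : (I × (Fin n → I)) × I =>
        H (q.1.1, (Fin.cons q.2 q.1.2 : Fin (n + 1) → I)) :=
      H.continuous.comp ((continuous_fst.comp continuous_fst).prodMk
        (hcons.comp ((continuous_snd.comp continuous_fst).prodMk continuous_snd)))
    refine ⟨⟨⟨⟨fun q => ⟨⟨fun t => H (q.1, Fin.cons t q.2), ?_⟩, (hH q.1 q.2).1, (hH q.1 q.2).2⟩,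
      ?_⟩, ?_, ?_⟩, ?_⟩⟩
    · exact hHc.comp (continuous_const.prodMk continuous_id)
    · exact Path.continuous_uncurry_iff.1 hHc
    · intro p
      ext t
      exact H.apply_zero _
    · intro p
      ext t
      exact H.apply_one _
    · intro s p hp
      ext t
      exact H.eq_fst s (Cube.mem_boundary_succ.2 (Or.inr (by rwa [Fin.tail_cons])))

end HasRelativeCubeLifting

end RelativeCubeLifting

/-! ### Mapping spaces of cubes and Kan fibrations -/

section HornRetraction

open scoped unitInterval

variable {n m : ℕ}

theorem unitInterval.abs_sub_half_le (t : I) : |(t : ℝ) - 1 / 2| ≤ 1 / 2 := by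
  rw [abs_le]
  constructor <;> linarith [t.2.1, t.2.2]

/-- The distance, in the sup norm, of a point of the cube to the center of the cube. -/
noncomputable def Cube.radius (t : Fin m → I) : ℝ := ‖fun l => (t l : ℝ) - 1 / 2‖

theorem Cube.continuous_radius : Continuous (Cube.radius (m := m)) := by
  unfold Cube.radius
  fun_prop

theorem Cube.radius_le_half (t : Fin m → I) : Cube.radius t ≤ 1 / 2 :=
  (pi_norm_le_iff_of_nonneg (by norm_num)).2 fun l => unitInterval.abs_sub_half_le (t l)

theorem Cube.abs_sub_half_le_radius (t : Fin m → I) (l : Fin m) :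
    |(t l : ℝ) - 1 / 2| ≤ Cube.radius t :=
  norm_le_pi_norm (fun l => (t l : ℝ) - 1 / 2) l

/-- In the sup norm the cube is the closed ball of radius `1/2` about its center, and its boundary
is the sphere. -/
theorem Cube.mem_boundary_iff_radius {t : Fin m → I} :
    t ∈ Cube.boundary (Fin m) ↔ Cube.radius t = 1 / 2 := by
  constructor
  · rintro ⟨l, hl⟩
    refine le_antisymm (radius_le_half t) (le_trans (le_of_eq ?_) (abs_sub_half_le_radius t l))
    rcases hl with hl | hl <;> rw [hl] <;> norm_num
  · intro h
    by_contra hc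
    have : radius t < 1 / 2 := by
      refine (pi_norm_lt_iff (by norm_num)).2 fun l => ?_
      rw [Real.norm_eq_abs]
      refine lt_of_le_of_ne (unitInterval.abs_sub_half_le (t l)) fun hl => hc ⟨l, ?_⟩
      rcases (abs_eq (by norm_num)).1 hl with hl | hl
      · exact Or.inr (Subtype.ext (show (t l : ℝ) = 1 by linarith))
      · exact Or.inl (Subtype.ext (show (t l : ℝ) = 0 by linarith))
    exact this.ne h

/-- Scaling of a point of the cube with respect to the center, projected to the cube. -/
noncomputable def Cube.scale (r : ℝ) (t : Fin m → I) : Fin m → I := fun l =>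
  Set.projIcc 0 1 zero_le_one (1 / 2 + r * ((t l : ℝ) - 1 / 2))

theorem Cube.continuous_scale {A : Type*} [TopologicalSpace A] {r : A → ℝ} {t : A → Fin m → I}
    (hr : Continuous r) (ht : Continuous t) : Continuous fun a => Cube.scale (r a) (t a) := by
  unfold Cube.scale
  refine continuous_pi fun l => continuous_projIcc.comp ?_
  fun_prop

/-- The bound keeps the scaled point inside the cube, so the projection in `Cube.scale` has no
effect. -/
theorem Cube.coe_scale {r : ℝ} {t : Fin m → I} (hr : 0 ≤ r) (h : r * radius t ≤ 1 / 2) (l : Fin m) :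
    (Cube.scale r t l : ℝ) = 1 / 2 + r * ((t l : ℝ) - 1 / 2) := by
  have h₁ : |r * ((t l : ℝ) - 1 / 2)| ≤ 1 / 2 := by
    rw [abs_mul, abs_of_nonneg hr]
    exact (mul_le_mul_of_nonneg_left (abs_sub_half_le_radius t l) hr).trans h
  rw [abs_le] at h₁
  unfold Cube.scale
  rw [Set.projIcc_of_mem _ (show _ ∈ Set.Icc (0 : ℝ) 1 from ⟨by linarith, by linarith⟩)]

theorem Cube.radius_scale {r : ℝ} {t : Fin m → I} (hr : 0 ≤ r) (h : r * radius t ≤ 1 / 2) :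
    radius (Cube.scale r t) = r * radius t := by
  have : (fun l => (Cube.scale r t l : ℝ) - 1 / 2) = r • fun l => (t l : ℝ) - 1 / 2 := by
    funext l
    rw [coe_scale hr h]
    simp
  rw [radius, this, norm_smul, Real.norm_of_nonneg hr]
  rfl

theorem Cube.scale_one (t : Fin m → I) : Cube.scale 1 t = t := by
  funext l
  refine Subtype.ext ?_
  rw [coe_scale zero_le_one (by rw [one_mul]; exact radius_le_half t)]
  ring

/-- The least of the coordinates of index `≠ i`. -/
noncomputable def stdSimplex.minCoord (i : Fin (n + 2)) (x : stdSimplex ℝ (Fin (n + 2))) : ℝ :=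
  Finset.univ.inf' Finset.univ_nonempty fun l : Fin (n + 1) => x (i.succAbove l)

theorem stdSimplex.continuous_apply {N : ℕ} (l : Fin N) :
    Continuous fun x : stdSimplex ℝ (Fin N) => x l :=
  (_root_.continuous_apply l).comp continuous_subtype_val

theorem stdSimplex.continuous_minCoord (i : Fin (n + 2)) :
    Continuous (stdSimplex.minCoord i) :=
  Continuous.finset_inf'_apply _ fun _ _ => stdSimplex.continuous_apply _

theorem stdSimplex.minCoord_le {i j : Fin (n + 2)} (h : j ≠ i) (x : stdSimplex ℝ (Fin (n + 2))) :
    stdSimplex.minCoord i x ≤ x j := by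
  obtain ⟨l, rfl⟩ := Fin.exists_succAbove_eq h
  exact Finset.inf'_le _ (Finset.mem_univ l)

theorem stdSimplex.minCoord_nonneg (i : Fin (n + 2)) (x : stdSimplex ℝ (Fin (n + 2))) :
    0 ≤ stdSimplex.minCoord i x :=
  Finset.le_inf' _ _ fun _ _ => stdSimplex.zero_le _ _

theorem stdSimplex.exists_eq_minCoord (i : Fin (n + 2)) (x : stdSimplex ℝ (Fin (n + 2))) :
    ∃ j ≠ i, x j = stdSimplex.minCoord i x := by
  obtain ⟨l, -, hl⟩ := Finset.exists_mem_eq_inf' (s := (Finset.univ : Finset (Fin (n + 1))))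
    Finset.univ_nonempty fun l : Fin (n + 1) => x (i.succAbove l)
  exact ⟨i.succAbove l, Fin.succAbove_ne i l, hl.symm⟩

/-- For `c` at most the coordinates of index `≠ i`, move a point of the simplex in the direction
of the vertex `i` by decreasing the other coordinates by `c`. -/
noncomputable def stdSimplex.shift (i : Fin (n + 2)) (x : stdSimplex ℝ (Fin (n + 2))) (c : ℝ)
    (hc₀ : 0 ≤ c) (hc : c ≤ stdSimplex.minCoord i x) : stdSimplex ℝ (Fin (n + 2)) :=
  ⟨fun l => x l + if l = i then (n + 1) * c else -c, fun l => by
    change 0 ≤ x l + if l = i then (n + 1) * c else -c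
    split_ifs with hl
    · have := stdSimplex.zero_le x l
      positivity
    · linarith [stdSimplex.minCoord_le hl x], by
    rw [Finset.sum_add_distrib, stdSimplex.sum_eq_one, Fin.sum_univ_succAbove _ i]
    simp⟩

/-- The union of `Λ × Iᵐ` and `Δ × ∂Iᵐ` is a retract of `Δ × Iᵐ`, for `Λ` the `i`-th horn of the
topological simplex `Δ`. -/
theorem exists_horn_cube_retraction (i : Fin (n + 2)) (m : ℕ) :
    ∃ R : C(stdSimplex ℝ (Fin (n + 2)) × (Fin m → I), stdSimplex ℝ (Fin (n + 2)) × (Fin m → I)),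
      (∀ p, (∃ j ≠ i, (R p).1 j = 0) ∨ (R p).2 ∈ Cube.boundary (Fin m)) ∧
      ∀ p, (∃ j ≠ i, p.1 j = 0) ∨ p.2 ∈ Cube.boundary (Fin m) → R p = p := by
  -- Push `x` towards the vertex `i` by `c` while expanding `t` from the center by `2 / (2 - c)`.
  -- The first bound says that `x` stays in the simplex, the second is `2 / (2 - c) * radius ≤ 1 /
  -- 2`. At the minimum one of them is attained, so the point lands on the horn or on the boundary
  -- of the cube; `c` vanishes if it was already there.
  let c : stdSimplex ℝ (Fin (n + 2)) × (Fin m → I) → ℝ := fun p =>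
    min (stdSimplex.minCoord i p.1) (2 - 4 * Cube.radius p.2)
  have hc : Continuous c := ((stdSimplex.continuous_minCoord i).comp continuous_fst).min
    (continuous_const.sub (continuous_const.mul (Cube.continuous_radius.comp continuous_snd)))
  have hc₀ : ∀ p, 0 ≤ c p := fun p =>
    le_min (stdSimplex.minCoord_nonneg _ _) (by linarith [Cube.radius_le_half p.2])
  have hcm : ∀ p, c p ≤ stdSimplex.minCoord i p.1 := fun p => min_le_left _ _
  have hcb : ∀ p, c p ≤ 2 - 4 * Cube.radius p.2 := fun p => min_le_right _ _
  have hc₁ : ∀ p, c p ≤ 1 := fun p => by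
    obtain ⟨j, -, hj⟩ := stdSimplex.exists_eq_minCoord i p.1
    exact (hcm p).trans (hj ▸ stdSimplex.le_one _ _)
  have hr : ∀ p, (2 / (2 - c p)) * Cube.radius p.2 ≤ 1 / 2 := fun p => by
    have := hc₁ p
    have := hcb p
    rw [div_mul_eq_mul_div, div_le_iff₀ (by linarith)]
    linarith
  have hr₀ : ∀ p, 0 ≤ 2 / (2 - c p) := fun p => by
    have := hc₁ p
    exact div_nonneg zero_le_two (by linarith)
  refine ⟨⟨fun p => ⟨stdSimplex.shift i p.1 (c p) (hc₀ p) (hcm p),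
    Cube.scale (2 / (2 - c p)) p.2⟩, ?_⟩, fun p => ?_, fun p hp => ?_⟩
  · refine Continuous.prodMk ?_ (Cube.continuous_scale ?_ continuous_snd)
    · refine Continuous.subtype_mk (continuous_pi fun l => ?_) _
      refine ((stdSimplex.continuous_apply l).comp continuous_fst).add ?_
      split_ifs
      · exact continuous_const.mul hc
      · exact hc.neg
    · exact continuous_const.div (continuous_const.sub hc) fun p => by
        have := hc₁ p
        linarith
  · rcases min_choice (stdSimplex.minCoord i p.1) (2 - 4 * Cube.radius p.2) with h | h
    · obtain ⟨j, hj, hj'⟩ := stdSimplex.exists_eq_minCoord i p.1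
      refine Or.inl ⟨j, hj, ?_⟩
      change p.1 j + (if j = i then _ else - c p) = 0
      rw [if_neg hj, hj', show c p = _ from h, add_neg_cancel]
    · refine Or.inr (Cube.mem_boundary_iff_radius.2 ?_)
      change Cube.radius (Cube.scale (2 / (2 - c p)) p.2) = _
      have h₁ := hc₁ p
      have h₂ : c p = _ := h
      rw [Cube.radius_scale (hr₀ p) (hr p), div_mul_eq_mul_div, div_eq_iff (by linarith)]
      linarith
  · have h0 : c p = 0 := by
      refine le_antisymm ?_ (hc₀ p)
      rcases hp with ⟨j, hj, hj'⟩ | hp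
      · exact (hcm p).trans ((stdSimplex.minCoord_le hj _).trans hj'.le)
      · have := hcb p
        rw [Cube.mem_boundary_iff_radius.1 hp] at this
        linarith
    refine Prod.ext (stdSimplex.ext (funext fun l => ?_)) ?_
    · change p.1 l + (if l = i then (n + 1) * c p else - c p) = p.1 l
      simp [h0]
    · change Cube.scale (2 / (2 - c p)) p.2 = p.2
      rw [h0, sub_zero, div_self two_ne_zero, Cube.scale_one]

theorem stdSimplex.map_succAbove_self (j : Fin (n + 2)) (a : stdSimplex ℝ (Fin (n + 1))) :
    stdSimplex.map j.succAbove a j = 0 := by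
  rw [stdSimplex.map_coe, FunOnFinite.linearMap_apply_apply]
  exact Finset.sum_eq_zero fun l hl => absurd (Finset.mem_filter.1 hl).2 (Fin.succAbove_ne j l)

theorem stdSimplex.map_succAbove_succAbove (j : Fin (n + 2)) (a : stdSimplex ℝ (Fin (n + 1)))
    (l : Fin (n + 1)) : stdSimplex.map j.succAbove a (j.succAbove l) = a l := by
  rw [stdSimplex.map_coe, FunOnFinite.linearMap_apply_apply]
  rw [Finset.sum_eq_single_of_mem l (by simp)]
  intro l' hl' hne
  exact absurd (Fin.succAbove_right_injective (Finset.mem_filter.1 hl').2) hne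

/-- A point of the simplex with vanishing `j`-th coordinate lies on the `j`-th face. -/
theorem stdSimplex.exists_map_succAbove_eq {j : Fin (n + 2)} {x : stdSimplex ℝ (Fin (n + 2))}
    (h : x j = 0) : ∃ a : stdSimplex ℝ (Fin (n + 1)), stdSimplex.map j.succAbove a = x := by
  refine ⟨⟨fun l => x (j.succAbove l), fun l => stdSimplex.zero_le _ _, ?_⟩,
    stdSimplex.ext (funext fun l => ?_)⟩
  · have := stdSimplex.sum_eq_one x
    rwa [Fin.sum_univ_succAbove _ j, h, zero_add] at this
  · induction l using j.succAboveCases with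
    | x => rw [stdSimplex.map_succAbove_self, h]
    | p l =>
      rw [stdSimplex.map_succAbove_succAbove]
      rfl

/-- A continuous map on a compact space descends along a continuous surjection to a Hausdorff
space. -/
theorem ContinuousMap.exists_comp_eq_of_surjective {P E T : Type*} [TopologicalSpace P]
    [CompactSpace P] [TopologicalSpace E] [T2Space E] [TopologicalSpace T] (p : C(P, E))
    (hp : Function.Surjective p) (φ : C(P, T)) (hφ : ∀ a b, p a = p b → φ a = φ b) :
    ∃ G : C(E, T), ∀ a, G (p a) = φ a := by
  have hq : Topology.IsQuotientMap p := p.continuous.isClosedMap.isQuotientMap p.continuous hp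
  refine ⟨⟨fun e => φ (hp e).choose, hq.continuous_iff.2 ?_⟩,
    fun a => hφ _ _ (hp (p a)).choose_spec⟩
  exact φ.continuous.congr fun a => (hφ _ _ (hp (p a)).choose_spec).symm

/-- Extension of a map from `Λ × Iᵐ ∪ Δ × ∂Iᵐ` to `Δ × Iᵐ`. -/
theorem exists_horn_cube_extension {T : Type*} [TopologicalSpace T] (i : Fin (n + 2)) (m : ℕ)
    (f : {j // j ≠ i} → C(stdSimplex ℝ (Fin (n + 1)), C(Fin m → I, T)))
    (g : C(stdSimplex ℝ (Fin (n + 2)), C(Cube.boundary (Fin m), T)))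
    (hf : ∀ (j k : {j // j ≠ i}) a b, stdSimplex.map j.1.succAbove a = stdSimplex.map k.1.succAbove b →
      f j a = f k b)
    (hfg : ∀ j a t, f j a t.1 = g (stdSimplex.map j.1.succAbove a) t) :
    ∃ F : C(stdSimplex ℝ (Fin (n + 2)), C(Fin m → I, T)),
      (∀ j a, F (stdSimplex.map j.1.succAbove a) = f j a) ∧ ∀ x t, F x t.1 = g x t := by
  obtain ⟨R, hR, hR'⟩ := exists_horn_cube_retraction i m
  have : CompactSpace (Cube.boundary (Fin m)) :=
    isCompact_iff_compactSpace.1 (Cube.isClosed_boundary m).isCompact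
  have hφ₁ : Continuous fun p : stdSimplex ℝ (Fin (n + 2)) × Cube.boundary (Fin m) => g p.1 p.2 :=
    (g.continuous.comp continuous_fst).eval continuous_snd
  have hφ₂ : ∀ j, Continuous fun q : stdSimplex ℝ (Fin (n + 1)) × (Fin m → I) => f j q.1 q.2 :=
    fun j => ((f j).continuous.comp continuous_fst).eval continuous_snd
  have hπ₁ : Continuous fun p : stdSimplex ℝ (Fin (n + 2)) × Cube.boundary (Fin m) =>
      (⟨(p.1, p.2.1), Or.inr p.2.2⟩ : {p : stdSimplex ℝ (Fin (n + 2)) × (Fin m → I) //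
        (∃ j ≠ i, p.1 j = 0) ∨ p.2 ∈ Cube.boundary (Fin m)}) :=
    (continuous_fst.prodMk (continuous_subtype_val.comp continuous_snd)).subtype_mk _
  have hπ₂ : ∀ j : {j // j ≠ i}, Continuous fun q : stdSimplex ℝ (Fin (n + 1)) × (Fin m → I) =>
      (⟨(stdSimplex.map j.1.succAbove q.1, q.2),
        Or.inl ⟨j.1, j.2, stdSimplex.map_succAbove_self _ _⟩⟩ :
        {p : stdSimplex ℝ (Fin (n + 2)) × (Fin m → I) //
          (∃ j ≠ i, p.1 j = 0) ∨ p.2 ∈ Cube.boundary (Fin m)}) := fun j =>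
    (((stdSimplex.continuous_map _).comp continuous_fst).prodMk continuous_snd).subtype_mk _
  -- The union is a quotient of the compact disjoint sum of its pieces `Δ × ∂Iᵐ` and facet `× Iᵐ`.
  -- The hypotheses `hf` and `hfg` say that the given maps agree on overlaps.
  obtain ⟨G, hG⟩ := ContinuousMap.exists_comp_eq_of_surjective
    (P := (stdSimplex ℝ (Fin (n + 2)) × Cube.boundary (Fin m)) ⊕
      (Σ _ : {j // j ≠ i}, stdSimplex ℝ (Fin (n + 1)) × (Fin m → I)))
    (E := {p : stdSimplex ℝ (Fin (n + 2)) × (Fin m → I) //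
      (∃ j ≠ i, p.1 j = 0) ∨ p.2 ∈ Cube.boundary (Fin m)})
    ⟨Sum.elim (fun p => ⟨(p.1, p.2.1), Or.inr p.2.2⟩) (fun q =>
      ⟨(stdSimplex.map q.1.1.succAbove q.2.1, q.2.2),
        Or.inl ⟨q.1.1, q.1.2, stdSimplex.map_succAbove_self _ _⟩⟩),
      hπ₁.sumElim (continuous_sigma fun j => hπ₂ j)⟩
    (by
      rintro ⟨⟨x, t⟩, ⟨j, hj, hj'⟩ | h⟩
      · obtain ⟨a, ha⟩ := stdSimplex.exists_map_succAbove_eq hj'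
        exact ⟨Sum.inr ⟨⟨j, hj⟩, (a, t)⟩, Subtype.ext (Prod.ext ha rfl)⟩
      · exact ⟨Sum.inl (x, ⟨t, h⟩), rfl⟩)
    ⟨Sum.elim (fun p => g p.1 p.2) (fun q => f q.1 q.2.1 q.2.2),
      hφ₁.sumElim (continuous_sigma fun j => hφ₂ j)⟩
    (by
      rintro (⟨x, t⟩ | ⟨j, a, t⟩) (⟨x', t'⟩ | ⟨j', a', t'⟩) h
      · obtain ⟨h₁, h₂⟩ := Prod.ext_iff.1 (congr_arg Subtype.val h)
        obtain rfl : x = x' := h₁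
        obtain rfl : t = t' := Subtype.ext h₂
        rfl
      · obtain ⟨h₁, h₂⟩ := Prod.ext_iff.1 (congr_arg Subtype.val h)
        obtain rfl : x = _ := h₁
        obtain rfl : t.1 = t' := h₂
        exact (hfg j' a' t).symm
      · obtain ⟨h₁, h₂⟩ := Prod.ext_iff.1 (congr_arg Subtype.val h)
        obtain rfl : _ = x' := h₁
        obtain rfl : t = t'.1 := h₂
        exact hfg j a t'
      · obtain ⟨h₁, h₂⟩ := Prod.ext_iff.1 (congr_arg Subtype.val h)
        obtain rfl : t = t' := h₂
        exact congr_arg (fun k : C(Fin m → I, T) => k t) (hf j j' a a' h₁))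
  let Φ : C(stdSimplex ℝ (Fin (n + 2)) × (Fin m → I), T) :=
    G.comp ⟨fun p => ⟨R p, hR p⟩, R.continuous.subtype_mk _⟩
  have hΦ : ∀ p hp, Φ p = G ⟨p, hp⟩ := fun p hp => congr_arg G (Subtype.ext (hR' _ hp))
  exact ⟨Φ.curry, fun j a => ContinuousMap.ext fun t =>
      (hΦ _ _).trans (hG (Sum.inr ⟨j, a, t⟩)),
    fun x t => (hΦ _ _).trans (hG (Sum.inl (x, t)))⟩

end HornRetraction

/-! ### Lifting horns against the restriction from a cube to its boundary. -/

section

open Simplicial HomotopicalAlgebra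
open SSet.modelCategoryQuillen hiding I
open scoped unitInterval

theorem stdSimplex.map_succAbove_injective {n : ℕ} (j : Fin (n + 2)) :
    Function.Injective (stdSimplex.map j.succAbove :
      stdSimplex ℝ (Fin (n + 1)) → stdSimplex ℝ (Fin (n + 2))) := fun a b h =>
  stdSimplex.ext (funext fun l => by
    rw [← stdSimplex.map_succAbove_succAbove j a l, h, stdSimplex.map_succAbove_succAbove])

/-- Two points of different facets of a simplex that coincide come from a facet of each. -/
theorem stdSimplex.exists_of_map_succAbove_eq {n : ℕ} {j k : Fin (n + 3)} (hjk : j < k)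
    {a b : stdSimplex ℝ (Fin (n + 2))}
    (h : stdSimplex.map j.succAbove a = stdSimplex.map k.succAbove b) :
    ∃ c, a = stdSimplex.map (k.pred (Fin.ne_zero_of_lt hjk)).succAbove c ∧
      b = stdSimplex.map (j.castPred (Fin.ne_last_of_lt hjk)).succAbove c := by
  obtain ⟨j, rfl⟩ := j.eq_castSucc_of_ne_last (Fin.ne_last_of_lt hjk)
  obtain ⟨k, rfl⟩ := k.eq_succ_of_ne_zero (Fin.ne_zero_of_lt hjk)
  rw [Fin.pred_succ, Fin.castPred_castSucc]
  have hjk' : j ≤ k := by grind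
  -- The common point lies on the facet `k.succ`, so that coordinate vanishes; in the facet
  -- `j.castSucc` it has index `k`.
  have ha : a k = 0 := by
    rw [← stdSimplex.map_succAbove_succAbove j.castSucc a k,
      Fin.succAbove_of_le_castSucc _ _ (Fin.castSucc_le_castSucc_iff.2 hjk'), h,
      stdSimplex.map_succAbove_self]
  obtain ⟨c, rfl⟩ := stdSimplex.exists_map_succAbove_eq ha
  refine ⟨c, rfl, stdSimplex.map_succAbove_injective _ (h.symm.trans ?_)⟩
  rw [stdSimplex.map_comp_apply, stdSimplex.map_comp_apply]
  congr 1
  funext l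
  exact congr_arg (fun f => f.toOrderHom l) (SimplexCategory.δ_comp_δ hjk').symm

theorem SSet.yonedaEquiv_δ_comp {X : SSet.{u}} {n : ℕ} (l : Fin (n + 2)) (s : Δ[n + 1] ⟶ X) :
    SSet.yonedaEquiv (SSet.stdSimplex.δ l ≫ s) = X.δ l (SSet.yonedaEquiv s) :=
  (SSet.yonedaEquiv_naturality (SimplexCategory.δ l) s).symm

theorem SSet.horn.yonedaEquiv_ι_comp {X : SSet.{u}} {n : ℕ} {i : Fin (n + 2)}
    (φ : (Λ[n + 1, i] : SSet.{u}) ⟶ X) (j : Fin (n + 2)) (hj : j ≠ i) :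
    SSet.yonedaEquiv (SSet.horn.ι i j hj ≫ φ) = φ.app _ (SSet.horn.face i j hj) := by
  rw [SSet.yonedaEquiv_comp, SSet.horn.yonedaEquiv_ι]

/-- Restriction of maps on a cube to the boundary of the cube. -/
def Cube.restrictBoundary (m : ℕ) (T : TopCat.{w}) :
    TopCat.of C(Fin m → I, T) ⟶ TopCat.of C(Cube.boundary (Fin m), T) :=
  TopCat.ofHom ⟨fun f => f.comp ⟨Subtype.val, continuous_subtype_val⟩,
    ContinuousMap.continuous_precomp _⟩

/-- By the exponential law, filling a horn here means extending a map from `Λ × Iᵐ ∪ Δ × ∂Iᵐ` to `Δ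
× Iᵐ`, which `exists_horn_cube_extension` does. -/
theorem Cube.fibration_toSSet_map_restrictBoundary (m : ℕ) (T : TopCat.{w}) :
    Fibration (TopCat.toSSet.map (Cube.restrictBoundary m T)) := by
  rw [SSet.modelCategoryQuillen.fibration_iff]
  intro A B i hi
  simp only [J, MorphismProperty.iSup_iff] at hi
  obtain ⟨n, ⟨i⟩⟩ := hi
  constructor
  intro φ ψ sq
  refine ⟨?_⟩
  let f (j : {j // j ≠ i}) : C(stdSimplex ℝ (Fin (n + 1)), C(Fin m → I, T)) :=
    TopCat.toSSetObjEquiv _ _ (φ.app _ (SSet.horn.face i j.1 j.2))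
  let g : C(stdSimplex ℝ (Fin (n + 2)), C(Cube.boundary (Fin m), T)) :=
    TopCat.toSSetObjEquiv _ _ (SSet.yonedaEquiv ψ)
  have hlt : ∀ (j k : {j // j ≠ i}) a b, j.1 < k.1 →
      stdSimplex.map j.1.succAbove a = stdSimplex.map k.1.succAbove b → f j a = f k b := by
    intro j k a b hjk h
    -- A horn in `Δ[1]` has a single facet, so two distinct ones exist only from `Δ[2]` on.
    obtain _ | n := n
    · exact absurd (show j.1 = k.1 by have := j.2; have := k.2; omega) hjk.ne
    · obtain ⟨c, rfl, rfl⟩ := stdSimplex.exists_of_map_succAbove_eq hjk h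
      have h' := SSet.horn.IsCompatible.of_hom φ j.1 k.1 j.2 k.2 hjk
      have hδ : ∀ (l : Fin (n + 2)) (j : {j // j ≠ i}),
          SSet.yonedaEquiv (SSet.stdSimplex.δ l ≫ SSet.horn.ι i j.1 j.2 ≫ φ) =
            (TopCat.toSSet.obj (TopCat.of C(Fin m → I, T))).δ l
              (φ.app _ (SSet.horn.face i j.1 j.2)) := fun l j =>
        (SSet.yonedaEquiv_δ_comp l _).trans
          (congr_arg _ (SSet.horn.yonedaEquiv_ι_comp φ j.1 j.2))
      have h₁ := ((hδ _ j).symm.trans (congr_arg SSet.yonedaEquiv h')).trans (hδ _ k)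
      have h₂ := DFunLike.congr_fun (congr_arg
        (TopCat.toSSetObjEquiv (TopCat.of C(Fin m → I, T)) (.op ⦋n⦌)) h₁) c
      exact (TopCat.toSSetObjEquiv_δ_apply _ _ c).symm.trans
        (h₂.trans (TopCat.toSSetObjEquiv_δ_apply _ _ c))
  obtain ⟨F, hF, hF'⟩ := exists_horn_cube_extension i m f g (fun j k a b h => by
      rcases lt_trichotomy j.1 k.1 with hjk | hjk | hjk
      · exact hlt j k a b hjk h
      · obtain rfl := Subtype.ext hjk
        rw [stdSimplex.map_succAbove_injective _ h]
      · exact (hlt k j b a hjk h.symm).symm)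
    (fun j a t => by
      have h' : (TopCat.toSSet.map (Cube.restrictBoundary m T)).app _
          (φ.app _ (SSet.horn.face i j.1 j.2)) =
            ψ.app _ (Λ[n + 1, i].ι.app _ (SSet.horn.face i j.1 j.2)) :=
        congr_arg (fun s : Λ[n + 1, i].toSSet ⟶ _ => s.app _ (SSet.horn.face i j.1 j.2)) sq.w
      have h'' : ψ.app _ (Λ[n + 1, i].ι.app _ (SSet.horn.face i j.1 j.2)) =
          (TopCat.toSSet.obj _).δ j.1 (SSet.yonedaEquiv ψ) := by
        rw [← SSet.yonedaEquiv_δ_comp, ← SSet.horn.ι_ι i j.1 j.2, Category.assoc,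
          SSet.horn.yonedaEquiv_ι_comp]
        rfl
      exact congr_arg (fun s => (TopCat.toSSetObjEquiv
        (TopCat.of C(Cube.boundary (Fin m), T)) _ s) a t) (h'.trans h''))
  constructor
  refine ⟨SSet.yonedaEquiv.symm ((TopCat.toSSetObjEquiv (TopCat.of C(Fin m → I, T)) _).symm F),
    ?_, ?_⟩
  · refine SSet.horn.hom_ext _ _ fun j hj => ?_
    apply (TopCat.toSSetObjEquiv _ _).injective
    refine ContinuousMap.ext fun a => ?_
    exact hF ⟨j, hj⟩ a
  · apply SSet.yonedaEquiv.injective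
    apply (TopCat.toSSetObjEquiv _ _).injective
    refine ContinuousMap.ext fun a => ContinuousMap.ext fun t => ?_
    rw [SSet.yonedaEquiv_comp, Equiv.apply_symm_apply]
    exact hF' a t

end

/-! ### Realization of anodyne extensions -/

section

open scoped unitInterval

/-- A collar of the boundary of the cube: `c` is homotopic to the identity relative to the boundary
and sends the collar `{p | 0 ≤ r p}` to the boundary. -/
theorem Cube.exists_collar (n : ℕ) : ∃ (c : C(Fin n → I, Fin n → I)) (r : C(Fin n → I, ℝ)),
    (∀ p, 0 ≤ r p → c p ∈ Cube.boundary (Fin n)) ∧ (∀ p ∈ Cube.boundary (Fin n), r p = 1) ∧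
    (∀ p ∈ Cube.boundary (Fin n), c p = p) ∧
    c.HomotopicRel (ContinuousMap.id _) (Cube.boundary (Fin n)) := by
  -- This is the minimum of `2` and `1 / (2 * radius)`: points of radius at least `1/4` go radially
  -- to the boundary, the others are doubled. The collar is therefore `0 ≤ 4 * radius - 1`, and
  -- interpolating the factor to `1` gives the homotopy.
  let ρ : (Fin n → I) → ℝ := fun p => 1 / max (1 / 2) (2 * Cube.radius p)
  have hm : ∀ p : Fin n → I, (0 : ℝ) < max (1 / 2) (2 * Cube.radius p) := fun p =>
    lt_max_of_lt_left (by norm_num)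
  have hρ : Continuous ρ := continuous_const.div
    (continuous_const.max (continuous_const.mul Cube.continuous_radius)) fun p => (hm p).ne'
  have hρ₁ : ∀ p ∈ Cube.boundary (Fin n), ρ p = 1 := fun p hp => by
    change 1 / max (1 / 2) (2 * Cube.radius p) = 1
    rw [Cube.mem_boundary_iff_radius.1 hp]
    norm_num
  refine ⟨⟨fun p => Cube.scale (ρ p) p, Cube.continuous_scale hρ continuous_id⟩,
    ⟨fun p => 4 * Cube.radius p - 1,
      (continuous_const.mul Cube.continuous_radius).sub continuous_const⟩,
    fun p hp => ?_, fun p hp => ?_, fun p hp => ?_, ⟨⟨⟨⟨fun q =>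
      Cube.scale ((1 - q.1) * ρ q.2 + q.1) q.2, ?_⟩, fun p => ?_, fun p => ?_⟩, fun t p hp => ?_⟩⟩⟩
  · change 0 ≤ 4 * Cube.radius p - 1 at hp
    have hs : 0 < Cube.radius p := by linarith
    have h1 : ρ p = 1 / (2 * Cube.radius p) := by
      change 1 / max (1 / 2) (2 * Cube.radius p) = _
      rw [max_eq_right (by linarith)]
    have h2 : ρ p * Cube.radius p = 1 / 2 := by
      rw [h1]
      field_simp
    refine Cube.mem_boundary_iff_radius.2 ?_
    change Cube.radius (Cube.scale (ρ p) p) = _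
    rw [Cube.radius_scale (by rw [h1]; positivity) h2.le, h2]
  · change 4 * Cube.radius p - 1 = 1
    rw [Cube.mem_boundary_iff_radius.1 hp]
    norm_num
  · change Cube.scale (ρ p) p = p
    rw [hρ₁ p hp, Cube.scale_one]
  · refine Cube.continuous_scale ?_ continuous_snd
    have : Continuous fun q : I × (Fin n → I) => (q.1 : ℝ) :=
      continuous_subtype_val.comp continuous_fst
    exact ((continuous_const.sub this).mul (hρ.comp continuous_snd)).add this
  · change Cube.scale ((1 - (0 : I)) * ρ p + (0 : I)) p = Cube.scale (ρ p) p
    simp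
  · change Cube.scale ((1 - (1 : I)) * ρ p + (1 : I)) p = p
    simp [Cube.scale_one]
  · change Cube.scale ((1 - (t : ℝ)) * ρ p + t) p = Cube.scale (ρ p) p
    rw [hρ₁ p hp]
    congr 1
    ring

/-- Gluing a map on the cube with a homotopy on a collar of the boundary. -/
theorem Cube.exists_collar_glue {n : ℕ} {Z T : Type*} [TopologicalSpace Z] [TopologicalSpace T]
    (c : C(Fin n → I, Fin n → I)) (r : C(Fin n → I, ℝ))
    (hc : ∀ p, 0 ≤ r p → c p ∈ Cube.boundary (Fin n)) (u : C(Cube.boundary (Fin n), Z))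
    (v : C(Fin n → I, T)) (E : C(Z × I, T)) (hE : ∀ p, E (u p, 0) = v p) :
    ∃ w : C(Fin n → I, T),
      (∀ p h, w p = E (u ⟨c p, hc p h⟩, Set.projIcc 0 1 zero_le_one (r p))) ∧
      ∀ p, ¬ 0 ≤ r p → w p = v (c p) := by
  let W : (Fin n → I) → T := fun p =>
    if h : 0 ≤ r p then E (u ⟨c p, hc p h⟩, Set.projIcc 0 1 zero_le_one (r p)) else v (c p)
  have hW₁ : ∀ p h, W p = E (u ⟨c p, hc p h⟩, Set.projIcc 0 1 zero_le_one (r p)) :=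
    fun p h => dif_pos h
  have hW₂ : ∀ p, ¬ 0 ≤ r p → W p = v (c p) := fun p h => dif_neg h
  suffices hW : Continuous W from ⟨⟨W, hW⟩, hW₁, hW₂⟩
  let A : Set (Fin n → I) := {p | 0 ≤ r p}
  let B : Set (Fin n → I) := {p | r p ≤ 0}
  have hA : IsClosed A := isClosed_le continuous_const r.continuous
  have hB : IsClosed B := isClosed_le r.continuous continuous_const
  have hAB : A ∪ B = Set.univ := Set.eq_univ_of_forall fun p => le_total 0 (r p)
  rw [← continuousOn_univ, ← hAB]
  refine ContinuousOn.union_of_isClosed ?_ ?_ hA hB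
  · rw [continuousOn_iff_continuous_domRestrict]
    have : Continuous fun p : A =>
        E (u ⟨c p.1, hc p.1 p.2⟩, Set.projIcc 0 1 zero_le_one (r p.1)) :=
      E.continuous.comp ((u.continuous.comp
        ((c.continuous.comp continuous_subtype_val).subtype_mk _)).prodMk
        (continuous_projIcc.comp (r.continuous.comp continuous_subtype_val)))
    refine this.congr fun p => ?_
    exact (hW₁ p.1 p.2).symm
  · refine (v.comp c).continuous.continuousOn.congr fun p hp => ?_
    by_cases h : 0 ≤ r p
    · have h0 : r p = 0 := le_antisymm hp h
      rw [hW₁ p h, h0, Set.projIcc_left]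
      exact hE _
    · exact hW₂ p h

end

/-! ### Extension problems against realized anodyne extensions. -/

section

open scoped unitInterval Simplicial
open SSet HomotopicalAlgebra
open scoped SSet.modelCategoryQuillen

variable {A B : SSet.{w}} {i : A ⟶ B}

/-- Maps on `|A| × Iᵐ ∪ |B| × ∂Iᵐ` extend to `|B| × Iᵐ` if `A ⟶ B` is anodyne. -/
theorem SSet.anodyneExtensions.exists_extension (hi : anodyneExtensions i) {T : Type w}
    [TopologicalSpace T] (m : ℕ) (f : C((|A| : TopCat.{w}) × (Fin m → I), T))
    (g : C((|B| : TopCat.{w}) × Cube.boundary (Fin m), T))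
    (h : ∀ a t, f (a, t.1) = g (toTop.map i a, t)) :
    ∃ F : C((|B| : TopCat.{w}) × (Fin m → I), T),
      (∀ a t, F (toTop.map i a, t) = f (a, t)) ∧ ∀ b t, F (b, t.1) = g (b, t) := by
  -- Curried in the cube variable, the problem is a lifting of `|i|` against restriction to `∂Iᵐ`;
  -- the adjunction transposes it to `i` against a Kan fibration.
  have : HasLiftingProperty i (TopCat.toSSet.map (Cube.restrictBoundary m (TopCat.of T))) :=
    hi _ ((HomotopicalAlgebra.fibration_iff _).1
      (Cube.fibration_toSSet_map_restrictBoundary m (TopCat.of T)))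
  have : HasLiftingProperty (toTop.map i) (Cube.restrictBoundary m (TopCat.of T)) :=
    (sSetTopAdj.hasLiftingProperty_iff _ _).2 this
  have sq : CommSq (TopCat.ofHom f.curry) (toTop.map i) (Cube.restrictBoundary m (TopCat.of T))
      (TopCat.ofHom g.curry) := ⟨by
    refine TopCat.hom_ext (ContinuousMap.ext fun a => ContinuousMap.ext fun t => ?_)
    exact h a t⟩
  refine ⟨ContinuousMap.uncurry sq.lift.hom, fun a t => ?_, fun b t => ?_⟩
  · have := congr_arg (fun s : |A| ⟶ TopCat.of C(Fin m → I, T) => s.hom a t) sq.fac_left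
    exact this
  · have := congr_arg (fun s : |B| ⟶ TopCat.of C(Cube.boundary (Fin m), T) => s.hom b t)
      sq.fac_right
    exact this

/-- Maps extend along the realization of an anodyne extension. -/
theorem SSet.anodyneExtensions.exists_comp_eq (hi : anodyneExtensions i) {T : Type w}
    [TopologicalSpace T] (f : C((|A| : TopCat.{w}), T)) :
    ∃ F : C((|B| : TopCat.{w}), T), ∀ a, F (toTop.map i a) = f a := by
  have : IsEmpty (Cube.boundary (Fin 0)) := ⟨fun p => p.2.elim fun l => l.elim0⟩
  obtain ⟨F, hF, -⟩ := hi.exists_extension 0 (f.comp ⟨_, continuous_fst⟩)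
    ⟨fun p => isEmptyElim p.2, continuous_of_const fun p => isEmptyElim p.2⟩
    fun a t => isEmptyElim t
  exact ⟨F.comp ⟨fun b => (b, fun l => l.elim0), continuous_id.prodMk continuous_const⟩,
    fun a => hF a _⟩

/-- Homotopies extend along the realization of an anodyne extension, with given ends. -/
theorem SSet.anodyneExtensions.exists_homotopy (hi : anodyneExtensions i) {T : Type w}
    [TopologicalSpace T] (f : C((|A| : TopCat.{w}) × I, T)) (g₀ g₁ : C((|B| : TopCat.{w}), T))
    (h₀ : ∀ a, g₀ (toTop.map i a) = f (a, 0)) (h₁ : ∀ a, g₁ (toTop.map i a) = f (a, 1)) :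
    ∃ F : C((|B| : TopCat.{w}) × I, T), (∀ a t, F (toTop.map i a, t) = f (a, t)) ∧
      (∀ b, F (b, 0) = g₀ b) ∧ ∀ b, F (b, 1) = g₁ b := by
  have h01 : ∀ t : Cube.boundary (Fin 1), t.1 0 = 0 ∨ t.1 0 = 1 := fun ⟨t, l, hl⟩ => by
    obtain rfl := Subsingleton.elim l 0
    exact hl
  -- `∂I¹` consists of two points, and the cutoff at `1/2` only tells them apart.
  obtain ⟨F, hF, hF'⟩ := hi.exists_extension 1
    (f.comp ⟨fun p => (p.1, p.2 0), by fun_prop⟩)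
    ⟨fun p => if p.2.1 0 ≤ unitInterval.mid then g₀ p.1 else g₁ p.1, by
      refine Continuous.if_le (g₀.continuous.comp continuous_fst)
        (g₁.continuous.comp continuous_fst) ((continuous_apply 0).comp (continuous_subtype_val.comp continuous_snd))
        continuous_const fun p hp => ?_
      rcases h01 p.2 with h | h
      · rw [h] at hp
        exact absurd (congr_arg Subtype.val hp) (by norm_num [unitInterval.mid])
      · exact absurd (h.symm.trans hp).le unitInterval.not_one_le_mid⟩
    (fun a t => by
      change f (a, t.1 0) = if t.1 0 ≤ _ then _ else _
      rcases h01 t with h | h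
      · rw [h, if_pos unitInterval.zero_le_mid, h₀]
      · rw [h, if_neg unitInterval.not_one_le_mid, h₁])
  refine ⟨F.comp ⟨fun p => (p.1, fun _ => p.2), by fun_prop⟩, fun a t => hF a _, fun b => ?_,
    fun b => ?_⟩
  · exact (hF' b ⟨fun _ => 0, 0, Or.inl rfl⟩).trans (if_pos unitInterval.zero_le_mid)
  · exact (hF' b ⟨fun _ => 1, 0, Or.inr rfl⟩).trans (if_neg unitInterval.not_one_le_mid)

/-- The realization is the inclusion of a strong deformation retract. If `r` is the retraction, `r
v` extends `u`, and the deformation applied to `v` is stationary on the boundary, where `v` takes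
values in the image of `|A|`. -/
theorem SSet.anodyneExtensions.hasRelativeCubeLifting (hi : anodyneExtensions i) :
    HasRelativeCubeLifting (toTop.map i).hom := by
  obtain ⟨r, hr⟩ := hi.exists_comp_eq (ContinuousMap.id (|A| : TopCat.{w}))
  obtain ⟨H, hH, hH₀, hH₁⟩ := hi.exists_homotopy
    ((toTop.map i).hom.comp ⟨Prod.fst, continuous_fst⟩) ((toTop.map i).hom.comp r)
    (ContinuousMap.id _) (fun a => congr_arg (toTop.map i) (hr a)) fun a => rfl
  intro n u v huv
  refine ⟨r.comp v, fun p => ?_, ⟨⟨⟨H.comp ⟨fun q => (v q.2, q.1), by fun_prop⟩, fun p => hH₀ _,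
    fun p => hH₁ _⟩, fun t p hp => ?_⟩⟩⟩
  · exact (congr_arg r (huv p)).symm.trans (hr _)
  · have h := huv ⟨p, hp⟩
    change H (v p, t) = toTop.map i (r (v p))
    rw [← h]
    exact (hH _ _).trans (congr_arg (toTop.map i) (hr _)).symm

/-- The realization of a retraction of an anodyne extension. -/
theorem SSet.anodyneExtensions.hasRelativeCubeLifting_of_comp_eq_id (hi : anodyneExtensions i)
    {q : B ⟶ A} (hq : i ≫ q = 𝟙 A) : HasRelativeCubeLifting (toTop.map q).hom := by
  have hq' : ∀ a, toTop.map q (toTop.map i a) = a := fun a => by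
    have := ConcreteCategory.congr_hom (congr_arg toTop.map hq) a
    simpa using this
  -- `D` is a homotopy from `i q` to the identity of `|B|`, stationary on `|A|`; its image under `q`
  -- is a loop at `q z` for each `z`.
  obtain ⟨D, hD, hD₀, hD₁⟩ := hi.exists_homotopy
    ((toTop.map i).hom.comp ⟨Prod.fst, continuous_fst⟩)
    ((toTop.map i).hom.comp (toTop.map q).hom) (ContinuousMap.id _)
    (fun a => congr_arg (toTop.map i) (hq' a)) fun a => rfl
  have hqD₀ : ∀ z, toTop.map q (D (z, 0)) = toTop.map q z := fun z =>
    (congr_arg (toTop.map q) (hD₀ z)).trans (hq' _)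
  have hqD₁ : ∀ z, toTop.map q (D (z, 1)) = toTop.map q z := fun z =>
    congr_arg (toTop.map q) (hD₁ z)
  -- `M` contracts the loops `q D(z, -)` relative to their ends: the side `t 1 = 0` of the square
  -- carries the loop, and the other three sides are constant at `q z`.
  obtain ⟨M, -, hM⟩ := hi.exists_extension 2 (T := (|A| : TopCat.{w})) ⟨Prod.fst, continuous_fst⟩
    ⟨fun p => if p.2.1 1 ≤ unitInterval.mid then toTop.map q (D (p.1, p.2.1 0))
        else toTop.map q p.1, by
      refine Continuous.if_le ((toTop.map q).hom.continuous.comp (D.continuous.comp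
        (continuous_fst.prodMk
          ((continuous_apply 0).comp (continuous_subtype_val.comp continuous_snd)))))
        ((toTop.map q).hom.continuous.comp continuous_fst)
        ((continuous_apply 1).comp (continuous_subtype_val.comp continuous_snd)) continuous_const
        fun p hp => ?_
      obtain ⟨z, t, l, hl⟩ := p
      change t 1 = unitInterval.mid at hp
      change toTop.map q (D (z, t 0)) = toTop.map q z
      have : l = 0 := by
        refine (Fin.eq_zero_or_eq_succ l).resolve_right ?_
        rintro ⟨l, rfl⟩
        obtain rfl := Subsingleton.elim l 0
        change t 1 = 0 ∨ t 1 = 1 at hl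
        rw [hp] at hl
        rcases hl with hl | hl
        · exact absurd (congr_arg Subtype.val hl) (by norm_num [unitInterval.mid])
        · exact absurd (congr_arg Subtype.val hl) (by norm_num [unitInterval.mid])
      subst this
      rcases hl with hl | hl
      · rw [hl, hqD₀]
      · rw [hl, hqD₁]⟩
    (fun a t => by
      change a = if _ then toTop.map q (D (toTop.map i a, t.1 0)) else toTop.map q (toTop.map i a)
      rw [hq', hD]
      split_ifs
      · exact (hq' a).symm
      · rfl)
  have hM₀ : ∀ z s, M (z, ![s, 0]) = toTop.map q (D (z, s)) := fun z s =>
    (hM z ⟨![s, 0], 1, Or.inl rfl⟩).trans (if_pos unitInterval.zero_le_mid)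
  have hM₁ : ∀ z s, M (z, ![s, 1]) = toTop.map q z := fun z s =>
    (hM z ⟨![s, 1], 1, Or.inr rfl⟩).trans (if_neg unitInterval.not_one_le_mid)
  have hM₂ : ∀ z t, M (z, ![0, t]) = toTop.map q z := fun z t =>
    (hM z ⟨![0, t], 0, Or.inl rfl⟩).trans (by
      change (if _ then toTop.map q (D (z, 0)) else _) = _
      rw [hqD₀, ite_self])
  have hM₃ : ∀ z t, M (z, ![1, t]) = toTop.map q z := fun z t =>
    (hM z ⟨![1, t], 0, Or.inr rfl⟩).trans (by
      change (if _ then toTop.map q (D (z, 1)) else _) = _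
      rw [hqD₁, ite_self])
  intro n u v huv
  obtain ⟨c, r, hc, hr, hc', hcid⟩ := Cube.exists_collar n
  -- The lift `i v` has boundary values `i q u` instead of `u`; on the collar, `D` moves them back
  -- to `u`.
  obtain ⟨w, hw₁, hw₂⟩ := Cube.exists_collar_glue c r hc u ((toTop.map i).hom.comp v) D fun p =>
    (hD₀ _).trans (congr_arg (toTop.map i) (huv p))
  -- The same gluing with values in paths: on the collar, `M` contracts the image of `D`, so that
  -- `K` joins `q w` to `v c`.
  obtain ⟨K, hK₁, hK₂⟩ := Cube.exists_collar_glue (T := C(I, (|A| : TopCat.{w}))) c r hc u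
    ((ContinuousMap.curry ⟨Prod.fst, continuous_fst⟩ : C(|A|, C(I, |A|))).comp v)
    (ContinuousMap.curry (M.comp ⟨fun p => (p.1.1, ![p.1.2, p.2]), by fun_prop⟩)) fun p =>
    ContinuousMap.ext fun t => (hM₂ _ _).trans (huv p)
  have hr' : ∀ p ∈ Cube.boundary (Fin n), 0 ≤ r p := fun p hp => (hr p hp).symm ▸ zero_le_one
  refine ⟨w, fun p => ?_, ContinuousMap.HomotopicRel.trans (g := v.comp c)
    ⟨⟨⟨(ContinuousMap.uncurry K).comp ⟨Prod.swap, continuous_swap⟩, fun p => ?_,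
      fun p => ?_⟩, fun t p hp => ?_⟩⟩ (hcid.comp_continuousMap v)⟩
  · rw [hw₁ p (hr' p p.2), hr p p.2, Set.projIcc_right]
    exact (hD₁ _).trans (congr_arg u (Subtype.ext (hc' p p.2)))
  · change K p 0 = toTop.map q (w p)
    by_cases h : 0 ≤ r p
    · rw [hw₁ p h, hK₁ p h]
      exact hM₀ _ _
    · rw [hw₂ p h, hK₂ p h]
      exact (hq' _).symm
  · change K p 1 = v (c p)
    by_cases h : 0 ≤ r p
    · rw [hK₁ p h]
      exact (hM₁ _ _).trans (huv _)
    · rw [hK₂ p h]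
      rfl
  · change K p t = toTop.map q (w p)
    rw [hw₁ p (hr' p hp), hK₁ p (hr' p hp), hr p hp, Set.projIcc_right]
    exact (hM₃ _ _).trans (hqD₁ _).symm

end

/-! ### Anodyne extensions of subcomplexes -/

section

open Simplicial SSet HomotopicalAlgebra Opposite MonoidalCategory Limits
open scoped SSet.modelCategoryQuillen

namespace SSet

/-- A homotopy that shows that the subcomplex `L` of `Z` is a weak deformation retract: it moves
`Z` into `L`, and preserves `L`. -/
structure DeformationInto {Z : SSet.{u}} (L : Z.Subcomplex) (h : Z ⊗ Δ[1] ⟶ Z) : Prop where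
  ι₁_comp : ι₁ ≫ h = 𝟙 Z
  ι₀_mem : ∀ (n : SimplexCategoryᵒᵖ) (x : Z.obj n), h.app n (ι₀.app n x) ∈ L.obj n
  mem : ∀ (n : SimplexCategoryᵒᵖ) (x : Z.obj n) (t : (Δ[1] : SSet.{u}).obj n), x ∈ L.obj n →
    h.app n (x, t) ∈ L.obj n

theorem eq_ι₀_app_of_mem_horn {Z : SSet.{u}} {n : SimplexCategoryᵒᵖ} (x : Z.obj n)
    (t : (Δ[1] : SSet.{u}).obj n) (ht : t ∈ (horn.{u} 1 0).obj n) :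
    ((x, t) : (Z ⊗ Δ[1]).obj n) = ι₀.app n x := by
  refine Prod.ext rfl ?_
  induction n using Opposite.rec with | _ n
  induction n using SimplexCategory.rec with | _ n
  rw [mem_horn_iff_notMem_range] at ht
  obtain ⟨j, hj, h⟩ := ht
  refine stdSimplex.ext _ _ fun k => ?_
  have hk : t k ≠ j := fun e => h ⟨k, e⟩
  refine Eq.trans ?_ (ι₀_app_snd_apply x k).symm
  change t k = 0
  generalize t k = a at hk
  omega

/-- Through `ι₁` and `h`, the inclusion of `L` is a retract of that of `L × Δ[1] ∪ Z × Λ[1, 0]` in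
`Z × Δ[1]`, a pushout-product with a horn inclusion. It is enough that `h` maps this union into `L`;
it need not fix `L` pointwise. -/
theorem DeformationInto.anodyneExtensions {Z : SSet.{u}} {L : Z.Subcomplex} {h : Z ⊗ Δ[1] ⟶ Z}
    (H : DeformationInto L h) : anodyneExtensions L.ι := by
  let U := L.unionProd (horn.{u} 1 0)
  have hU : SSet.anodyneExtensions U.ι :=
    anodyneExtensions_unionProd_ι L (horn.{u} 1 0) (anodyneExtensions.horn_ι 0)
  have hr : ∀ (n : SimplexCategoryᵒᵖ) (p : U.obj n), h.app n p.1 ∈ L.obj n := by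
    rintro n ⟨⟨x, t⟩, hp⟩
    rcases (Subcomplex.mem_unionProd_iff L (horn.{u} 1 0) (x, t)).1 hp with ht | hx
    · have := H.ι₀_mem n x
      rwa [← eq_ι₀_app_of_mem_horn x t ht] at this
    · exact H.mem n x t hx
  let i : (L : SSet.{u}) ⟶ U := Subcomplex.lift (L.ι ≫ ι₁) (by
    rintro n _ ⟨x, rfl⟩
    exact (Subcomplex.mem_unionProd_iff L (horn.{u} 1 0) _).2 (Or.inr x.2))
  let r : (U : SSet.{u}) ⟶ L := Subcomplex.lift (U.ι ≫ h) (by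
    rintro n _ ⟨x, rfl⟩
    exact hr n x)
  have hir : i ≫ r = 𝟙 _ := by
    rw [← cancel_mono L.ι]
    change L.ι ≫ ι₁ ≫ h = L.ι
    rw [H.ι₁_comp, Category.comp_id]
  exact MorphismProperty.of_retract ({
    i := Arrow.homMk (f := Arrow.mk L.ι) (g := Arrow.mk U.ι) i ι₁ rfl
    r := Arrow.homMk (f := Arrow.mk U.ι) (g := Arrow.mk L.ι) r h rfl
    retract := Arrow.hom_ext _ _ hir H.ι₁_comp } : RetractArrow _ _) hU

/-- Gluing a simplicial set `P` to a subcomplex `A` along a subcomplex `U` of `P`. -/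
theorem anodyneExtensions_homOfLE {Y P : SSet.{u}} {A B : Y.Subcomplex} (hAB : A ≤ B)
    (U : P.Subcomplex) (hU : anodyneExtensions U.ι) (φ : P ⟶ Y)
    (hφ : ∀ n x, φ.app n x ∈ B.obj n)
    (hUA : ∀ n x, x ∈ U.obj n ↔ φ.app n x ∈ A.obj n)
    (hB : ∀ n y, y ∈ B.obj n → y ∈ A.obj n ∨ ∃ x, φ.app n x = y)
    (hinj : ∀ n x x', x ∉ U.obj n → x' ∉ U.obj n → φ.app n x = φ.app n x' → x = x') :
    anodyneExtensions (Subcomplex.homOfLE hAB) := by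
  let t : (U : SSet.{u}) ⟶ A := Subcomplex.lift (U.ι ≫ φ) (by
    rintro n _ ⟨x, rfl⟩
    exact (hUA n x).1 x.2)
  let b : P ⟶ B := Subcomplex.lift φ (by
    rintro n _ ⟨x, rfl⟩
    exact hφ n x)
  have w : t ≫ Subcomplex.homOfLE hAB = U.ι ≫ b := rfl
  -- Pushouts are checked levelwise. In sets, a pullback square over an injection is a pushout once
  -- the two images cover and `b` is injective off `U`.
  have sq : IsPushout t U.ι (Subcomplex.homOfLE hAB) b :=
    { w := w
      isColimit' := ⟨evaluationJointlyReflectsColimits _ (fun n => by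
        refine (isColimitMapCoconePushoutCoconeEquiv _ _).2 (IsPushout.isColimit ?_)
        have : Mono ((Subcomplex.homOfLE hAB).app n) := inferInstance
        refine Types.isPushout_of_isPullback_of_mono' ?_ ?_ ?_
        · rw [Types.isPullback_iff]
          refine ⟨NatTrans.congr_app w n, fun x₁ x₂ hx => Subtype.ext hx.2, fun x y hxy => ?_⟩
          have hxy' : x.1 = φ.app n y := congr_arg Subtype.val hxy
          exact ⟨⟨y, (hUA n y).2 (hxy' ▸ x.2)⟩, Subtype.ext hxy'.symm, rfl⟩
        · refine Set.eq_univ_of_forall fun y => ?_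
          rcases hB n y.1 y.2 with h | ⟨x, hx⟩
          · exact Or.inl ⟨⟨y.1, h⟩, rfl⟩
          · exact Or.inr ⟨x, Subtype.ext hx⟩
        · intro x x' hx hx' h
          exact hinj n x x' (fun h => hx ⟨⟨x, h⟩, rfl⟩) (fun h => hx' ⟨⟨x', h⟩, rfl⟩)
            (congr_arg Subtype.val h))⟩ }
  exact MorphismProperty.of_isPushout sq hU

/-- An exhaustive filtration with anodyne inclusions. -/
theorem anodyneExtensions_of_filtration {Y : SSet.{u}} (F : ℕ →o Y.Subcomplex)
    (hF : ∀ n, anodyneExtensions (Subcomplex.homOfLE (F.monotone (Nat.le_succ n))))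
    (hsup : ∀ n x, ∃ m, x ∈ (F m).obj n) : anodyneExtensions (F 0).ι := by
  have htop : ⨆ m, F m = ⊤ := by
    ext n x
    simpa using hsup n x
  refine MorphismProperty.transfiniteCompositionsOfShape_le anodyneExtensions ℕ _ ⟨
    { F := F.monotone.functor ⋙ Subcomplex.toSSetFunctor
      isoBot := Iso.refl _
      incl := { app := fun _ => Subcomplex.ι _ }
      isColimit := IsColimit.ofIsoColimit (isColimitOfPreserves (Subcomplex.toSSetFunctor)
        ((CompleteLattice.colimitCocone (F.monotone.functor)).isColimit))
          (Cocone.ext (Subcomplex.eqToIso htop ≪≫ Subcomplex.topIso Y))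
      map_mem := fun n _ => hF n }⟩

end SSet

end

/-! ### Diagonals of bisimplicial sets -/

section

open Simplicial SSet HomotopicalAlgebra Opposite MonoidalCategory Limits
open scoped SSet.modelCategoryQuillen

theorem SimplexCategory.exists_epi_mono_factorisation {n m : SimplexCategory} (f : n ⟶ m) :
    ∃ (j : ℕ) (e : n ⟶ ⦋j⦌) (i : ⦋j⦌ ⟶ m), Epi e ∧ j ≤ m.len ∧ e ≫ i = f ∧
      (j = m.len → Epi f) := by
  refine ⟨(image f).len, factorThruImage f, image.ι f, inferInstance,
    SimplexCategory.len_le_of_mono (image.ι f), image.fac f, fun h => ?_⟩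
  have : IsIso (image.ι f) := (SimplexCategory.isIso_iff_of_mono (image.ι f)).2 h
  rw [← image.fac f]
  infer_instance

namespace SSet

/-- A bisimplicial subset of a bisimplicial set. -/
structure BisimplicialSubset (Z : SimplexCategoryᵒᵖ ⥤ SSet.{u}) where
  /-- the rows -/
  obj (k : SimplexCategoryᵒᵖ) : (Z.obj k).Subcomplex
  map_mem {k l : SimplexCategoryᵒᵖ} (f : k ⟶ l) {n : SimplexCategoryᵒᵖ} {x : (Z.obj k).obj n}
    (hx : x ∈ (obj k).obj n) : (Z.map f).app n x ∈ (obj l).obj n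

namespace BisimplicialSubset

variable {Z : SimplexCategoryᵒᵖ ⥤ SSet.{u}} (X : BisimplicialSubset Z)

theorem naturality_apply {k l n n' : SimplexCategoryᵒᵖ} (f : k ⟶ l) (g : n ⟶ n')
    (x : (Z.obj k).obj n) :
    (Z.map f).app n' ((Z.obj k).map g x) = (Z.obj l).map g ((Z.map f).app n x) :=
  ConcreteCategory.congr_hom ((Z.map f).naturality g) x

theorem map_comp_app {k l m n : SimplexCategoryᵒᵖ} (f : k ⟶ l) (g : l ⟶ m)
    (x : (Z.obj k).obj n) :
    (Z.map (f ≫ g)).app n x = (Z.map g).app n ((Z.map f).app n x) := by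
  rw [Functor.map_comp]
  rfl

theorem map_id_app {k n : SimplexCategoryᵒᵖ} (x : (Z.obj k).obj n) :
    (Z.map (𝟙 k)).app n x = x := by
  rw [CategoryTheory.Functor.map_id]
  rfl

/-- The diagonal of a bisimplicial subset. -/
def diag : (bisimplicialDiag.obj Z).Subcomplex where
  obj n := (X.obj n).obj n
  map {_ n'} f _ hx := (X.obj n').map f (X.map_mem f hx)

/-- The bisimplicial subset generated by `X` and the rows of index less than `m`. -/
def filtration (m : ℕ) : BisimplicialSubset Z where
  obj k :=
    { obj := fun n => {x | x ∈ (X.obj k).obj n ∨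
        ∃ (j : ℕ) (_ : j < m) (f : op ⦋j⦌ ⟶ k) (y : (Z.obj (op ⦋j⦌)).obj n),
          x = (Z.map f).app n y}
      map := by
        rintro n n' g x (hx | ⟨j, hj, f, y, rfl⟩)
        · exact Or.inl ((X.obj k).map g hx)
        · exact Or.inr ⟨j, hj, f, (Z.obj _).map g y, (naturality_apply f g y).symm⟩ }
  map_mem := by
    rintro k l f n x (hx | ⟨j, hj, g, y, rfl⟩)
    · exact Or.inl (X.map_mem f hx)
    · exact Or.inr ⟨j, hj, g ≫ f, y, (map_comp_app g f y).symm⟩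

theorem mem_filtration {m : ℕ} {k n : SimplexCategoryᵒᵖ} {x : (Z.obj k).obj n} :
    x ∈ ((X.filtration m).obj k).obj n ↔ x ∈ (X.obj k).obj n ∨
      ∃ (j : ℕ) (_ : j < m) (f : op ⦋j⦌ ⟶ k) (y : (Z.obj (op ⦋j⦌)).obj n),
        x = (Z.map f).app n y := Iff.rfl

theorem mem_filtration_succ {m : ℕ} {k n : SimplexCategoryᵒᵖ} {x : (Z.obj k).obj n} :
    x ∈ ((X.filtration (m + 1)).obj k).obj n ↔ x ∈ ((X.filtration m).obj k).obj n ∨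
      ∃ (f : op ⦋m⦌ ⟶ k) (y : (Z.obj (op ⦋m⦌)).obj n), x = (Z.map f).app n y := by
  rw [mem_filtration, mem_filtration, or_assoc]
  refine or_congr_right ⟨?_, ?_⟩
  · rintro ⟨j, hj, f, y, h⟩
    rcases Nat.lt_succ_iff_lt_or_eq.1 hj with hj | rfl
    · exact Or.inl ⟨j, hj, f, y, h⟩
    · exact Or.inr ⟨f, y, h⟩
  · rintro (⟨j, hj, f, y, h⟩ | ⟨f, y, h⟩)
    · exact ⟨j, hj.trans (Nat.lt_succ_self m), f, y, h⟩
    · exact ⟨m, Nat.lt_succ_self m, f, y, h⟩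

/-- The filtration of the diagonal. -/
def diagFiltration : ℕ →o (bisimplicialDiag.obj Z).Subcomplex where
  toFun m := (X.filtration m).diag
  monotone' := monotone_nat_of_le_succ fun _ _ _ hx => (X.mem_filtration_succ).2 (Or.inl hx)

theorem diagFiltration_zero : X.diagFiltration 0 = X.diag := by
  ext n x
  refine ⟨?_, fun hx => Or.inl hx⟩
  rintro (hx | ⟨j, hj, -⟩)
  · exact hx
  · exact absurd hj (Nat.not_lt_zero j)

/-- The map to the diagonal given by a row. -/
def cell (Z : SimplexCategoryᵒᵖ ⥤ SSet.{u}) (m : ℕ) :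
    Δ[m] ⊗ Z.obj (op ⦋m⦌) ⟶ bisimplicialDiag.obj Z where
  app n := TypeCat.ofHom fun p => (Z.map (stdSimplex.objEquiv p.1).op).app n p.2
  naturality n n' f := by
    ext ⟨t, x⟩
    exact (naturality_apply _ f x).trans (congr_arg ((Z.obj n').map f)
      (map_comp_app (stdSimplex.objEquiv t).op f x))

theorem cell_app_apply {m : ℕ} {n : SimplexCategoryᵒᵖ} (t : (Δ[m] : SSet.{u}).obj n)
    (x : (Z.obj (op ⦋m⦌)).obj n) :
    (cell Z m).app n (t, x) = (Z.map (stdSimplex.objEquiv t).op).app n x := rfl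

theorem epi_objEquiv_of_notMem_boundary {m : ℕ} {n : SimplexCategoryᵒᵖ}
    {t : (Δ[m] : SSet.{u}).obj n} (ht : t ∉ (boundary.{u} m).obj n) :
    Epi (stdSimplex.objEquiv t) := by
  rw [SimplexCategory.epi_iff_surjective]
  exact not_not.1 ht

/-- Epimorphisms of the simplex category split, so a section recovers `x` from its degeneracy. -/
theorem map_mem_iff_of_epi {k l : SimplexCategory} (f : l ⟶ k) [Epi f] {n : SimplexCategoryᵒᵖ}
    {x : (Z.obj (op k)).obj n} :
    (Z.map f.op).app n x ∈ (X.obj (op l)).obj n ↔ x ∈ (X.obj (op k)).obj n := by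
  refine ⟨fun h => ?_, X.map_mem _⟩
  have := isSplitEpi_of_epi f
  have := X.map_mem (section_ f).op h
  rwa [← map_comp_app, ← op_comp, IsSplitEpi.id, op_id, map_id_app] at this

/-- If `t` lies in `∂Δ[m]`, it factors through a dimension below `m`, and the cell comes from an
earlier row. Otherwise `t` is an epimorphism and membership is reflected. -/
theorem mem_unionProd_iff_cell_mem (m : ℕ) (n : SimplexCategoryᵒᵖ)
    (p : (Δ[m] ⊗ Z.obj (op ⦋m⦌)).obj n) :
    p ∈ ((boundary.{u} m).unionProd ((X.filtration m).obj (op ⦋m⦌))).obj n ↔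
      (cell Z m).app n p ∈ (X.diagFiltration m).obj n := by
  obtain ⟨t, x⟩ := p
  refine (Subcomplex.mem_unionProd_iff _ _ (t, x)).trans ?_
  rw [cell_app_apply]
  by_cases ht : t ∈ (boundary.{u} m).obj n
  · refine iff_of_true (Or.inr ht) (Or.inr ?_)
    obtain ⟨j, e, i, -, hj, hei, he⟩ :=
      SimplexCategory.exists_epi_mono_factorisation (stdSimplex.objEquiv t)
    refine ⟨j, hj.lt_of_ne fun hj => ?_, e.op, (Z.map i.op).app n x, ?_⟩
    · have := he hj
      exact ht (SimplexCategory.epi_iff_surjective.1 this)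
    · rw [← hei, op_comp, map_comp_app]
  · have := epi_objEquiv_of_notMem_boundary ht
    refine (or_iff_left ht).trans ?_
    exact ((X.filtration m).map_mem_iff_of_epi (stdSimplex.objEquiv t)).symm

/-- Eilenberg–Zilber in the row direction: off the union, `t` is an epimorphism and `x` is
nondegenerate, and such a decomposition is unique. -/
theorem cell_injective (m : ℕ) (n : SimplexCategoryᵒᵖ)
    (p p' : (Δ[m] ⊗ Z.obj (op ⦋m⦌)).obj n)
    (hp : p ∉ ((boundary.{u} m).unionProd ((X.filtration m).obj (op ⦋m⦌))).obj n)
    (hp' : p' ∉ ((boundary.{u} m).unionProd ((X.filtration m).obj (op ⦋m⦌))).obj n)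
    (h : (cell Z m).app n p = (cell Z m).app n p') : p = p' := by
  obtain ⟨t, x⟩ := p
  obtain ⟨t', x'⟩ := p'
  replace hp := not_or.1 (mt (Subcomplex.mem_unionProd_iff _ _ (t, x)).2 hp)
  replace hp' := not_or.1 (mt (Subcomplex.mem_unionProd_iff _ _ (t', x')).2 hp')
  have hx : ∀ x, x ∉ ((X.filtration m).obj (op ⦋m⦌)).obj n →
      x ∈ SSet.nonDegenerate (Z ⋙ (evaluation _ _).obj n) m := by
    rintro x hx ⟨j, hj, f, y, hy⟩
    exact hx (Or.inr ⟨j, hj, f.op, y, hy.symm⟩)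
  have := epi_objEquiv_of_notMem_boundary hp.2
  induction n using Opposite.rec with | _ n
  induction n using SimplexCategory.rec with | _ n
  have h₁ := SSet.unique_nonDegenerate_simplex (Z ⋙ (evaluation _ _).obj (op ⦋n⦌)) _
    (stdSimplex.objEquiv t) ⟨x, hx x hp.1⟩ rfl (stdSimplex.objEquiv t') ⟨x', hx x' hp'.1⟩ h
  have h₂ := SSet.unique_nonDegenerate_map (Z ⋙ (evaluation _ _).obj (op ⦋n⦌)) _
    (stdSimplex.objEquiv t) ⟨x, hx x hp.1⟩ rfl (stdSimplex.objEquiv t') ⟨x', hx x' hp'.1⟩ h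
  exact Prod.ext (stdSimplex.objEquiv.injective h₂) (congr_arg Subtype.val h₁)

/-- The inclusion of the diagonal of a bisimplicial subset is anodyne if the rows are weak
deformation retracts compatibly with the degeneracies. -/
theorem anodyneExtensions_diag (h : ∀ k, Z.obj (op k) ⊗ Δ[1] ⟶ Z.obj (op k))
    (H : ∀ k, DeformationInto (X.obj (op k)) (h k))
    (hepi : ∀ {k l : SimplexCategory} (f : l ⟶ k) [Epi f] (n : SimplexCategoryᵒᵖ)
      (x : (Z.obj (op k)).obj n) (t : (Δ[1] : SSet.{u}).obj n),
      (h l).app n ((Z.map f.op).app n x, t) = (Z.map f.op).app n ((h k).app n (x, t))) :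
    anodyneExtensions X.diag.ι := by
  -- Elements added from lower rows must stay in the filtration. Factoring the operator as a face
  -- followed by a degeneracy, the homotopy commutes with the degeneracy and can be applied in a row
  -- of index still below `m`.
  have hF : ∀ m, DeformationInto ((X.filtration m).obj (op ⦋m⦌)) (h ⦋m⦌) := fun m =>
    { ι₁_comp := (H _).ι₁_comp
      ι₀_mem := fun n x => Or.inl ((H _).ι₀_mem n x)
      mem := by
        rintro n x t (hx | ⟨j, hj, f, y, rfl⟩)
        · exact Or.inl ((H _).mem n x t hx)
        · obtain ⟨j', e, i, _, hj', hei, -⟩ :=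
            SimplexCategory.exists_epi_mono_factorisation f.unop
          have hf : f = i.op ≫ e.op := Quiver.Hom.unop_inj hei.symm
          rw [hf, map_comp_app, hepi]
          exact Or.inr ⟨j', hj'.trans_lt hj, e.op, _, rfl⟩ }
  rw [← X.diagFiltration_zero]
  refine anodyneExtensions_of_filtration X.diagFiltration (fun m => ?_) fun n x => ?_
  · refine anodyneExtensions_homOfLE _ _
      (anodyneExtensions_unionProd_ι (boundary.{u} m) _ (hF m).anodyneExtensions) (cell Z m) ?_
      (X.mem_unionProd_iff_cell_mem m) ?_ (X.cell_injective m)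
    · rintro n ⟨t, x⟩
      exact X.mem_filtration_succ.2 (Or.inr ⟨(stdSimplex.objEquiv t).op, x, rfl⟩)
    · intro n y hy
      refine (X.mem_filtration_succ.1 hy).imp_right ?_
      rintro ⟨f, x, rfl⟩
      exact ⟨(stdSimplex.objEquiv.symm f.unop, x), by
        rw [cell_app_apply, Equiv.apply_symm_apply]; rfl⟩
  · exact ⟨n.unop.len + 1, Or.inr ⟨n.unop.len, Nat.lt_succ_self _, 𝟙 n, x,
      (map_id_app x).symm⟩⟩

end BisimplicialSubset

end SSet

end

/-! ### Nerves of simplicial groupoids -/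

section

open Simplicial SSet HomotopicalAlgebra Opposite MonoidalCategory Limits

/-- A levelwise surjection over a simplicial set has a section that is compatible with the
degeneracies. -/
theorem SSet.exists_section_of_surjective (Y : SSet.{u}) {E : SimplexCategory → Type w}
    (p : ∀ k, E k → Y.obj (op k)) (act : ∀ {k l : SimplexCategory} (_ : l ⟶ k), E k → E l)
    (act_comp : ∀ {k l m : SimplexCategory} (g : m ⟶ l) (f : l ⟶ k) (e : E k),
      act (g ≫ f) e = act g (act f e))
    (hp : ∀ {k l : SimplexCategory} (f : l ⟶ k) (e : E k), p l (act f e) = Y.map f.op (p k e))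
    (hsurj : ∀ k, Function.Surjective (p k)) :
    ∃ S : ∀ k, Y.obj (op k) → E k, (∀ k u, p k (S k u) = u) ∧
      ∀ {k l : SimplexCategory} (f : l ⟶ k) [Epi f] (u : Y.obj (op k)),
        S l (Y.map f.op u) = act f (S k u) := by
  choose s hs using hsurj
  -- Choose preimages of nondegenerate simplices only, and transport them along degeneracies.
  choose m f hf y hy using fun (k : ℕ) (u : Y.obj (op ⦋k⦌)) => SSet.exists_nonDegenerate Y u
  refine ⟨fun k u => act (f k.len u) (s _ (y k.len u).1), fun k u => ?_, fun {k l} g _ u => ?_⟩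
  · refine (hp _ _).trans ?_
    rw [hs]
    exact (hy k.len u).symm
  · change act (f l.len (Y.map g.op u)) (s _ (y l.len (Y.map g.op u)).1) =
      act g (act (f k.len u) (s _ (y k.len u).1))
    rw [← act_comp]
    have := hf k.len u
    -- A second decomposition of the degenerate simplex; uniqueness identifies it with the chosen
    -- one. It needs `g` to be epi, so faces are excluded.
    have hu : Y.map g.op u = Y.map (g ≫ f k.len u).op (y k.len u).1 := by
      rw [op_comp, Functor.map_comp_apply]
      exact congr_arg (Y.map g.op) (hy k.len u)
    have h₁ := hy l.len (Y.map g.op u)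
    have h₂ := hf l.len (Y.map g.op u)
    revert h₁ h₂
    generalize f l.len (Y.map g.op u) = f'
    generalize y l.len (Y.map g.op u) = y'
    generalize m l.len (Y.map g.op u) = m' at f' y'
    intro h₁ h₂
    obtain rfl := Y.unique_nonDegenerate_dim (n := l.len) (Y.map g.op u) f' y' h₁
      (g ≫ f k.len u) (y k.len u) hu
    rw [Y.unique_nonDegenerate_simplex (n := l.len) (Y.map g.op u) f' y' h₁
      (g ≫ f k.len u) (y k.len u) hu, Y.unique_nonDegenerate_map (n := l.len) (Y.map g.op u) f' y' h₁
      (g ≫ f k.len u) (y k.len u) hu]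

namespace CategoryTheory

/-- A functor to a groupoid, conjugated by a family of morphisms to its values. -/
def Functor.conjugate {J C : Type*} [Category* J] [Groupoid C] (F : J ⥤ C) (e : J → Arrow C)
    (he : ∀ j, (e j).right = F.obj j) : J ⥤ C where
  obj j := (e j).left
  map {i j} f := (e i).hom ≫ eqToHom (he i) ≫ F.map f ≫ eqToHom (he j).symm ≫ Groupoid.inv (e j).hom

theorem Functor.conjugate_congr {J C : Type*} [Category* J] [Groupoid C] (F : J ⥤ C)
    {e e' : J → Arrow C} (he : ∀ j, (e j).right = F.obj j) (h : e = e') :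
    F.conjugate e he = F.conjugate e' (fun j => by rw [← h, he]) := by
  subst h
  rfl

theorem Functor.conjugate_comp {J C D : Type*} [Category* J] [Groupoid C] [Groupoid D]
    (F : J ⥤ C) (e : J → Arrow C) (he : ∀ j, (e j).right = F.obj j) (H : C ⥤ D) :
    (F ⋙ H).conjugate (fun j => H.mapArrow.obj (e j)) (fun j => congr_arg H.obj (he j)) =
      F.conjugate e he ⋙ H := by
  refine CategoryTheory.Functor.hext (fun _ => rfl) fun i j f => heq_of_eq ?_
  change H.map (e i).hom ≫ eqToHom (congr_arg H.obj (he i)) ≫ H.map (F.map f) ≫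
    eqToHom (congr_arg H.obj (he j)).symm ≫ Groupoid.inv (H.map (e j).hom) =
    H.map ((e i).hom ≫ eqToHom (he i) ≫ F.map f ≫ eqToHom (he j).symm ≫ Groupoid.inv (e j).hom)
  simp [eqToHom_map]

theorem Functor.conjugate_id {J C : Type*} [Category* J] [Groupoid C] (F : J ⥤ C) :
    F.conjugate (fun j => Arrow.mk (𝟙 (F.obj j))) (fun _ => rfl) = F := by
  refine CategoryTheory.Functor.hext (fun _ => rfl) fun i j f => heq_of_eq ?_
  change 𝟙 _ ≫ 𝟙 _ ≫ F.map f ≫ 𝟙 _ ≫ Groupoid.inv (𝟙 _) = F.map f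
  simp

end CategoryTheory

/-- A simplicial set of objects of a simplicial category. -/
structure SimplicialObjectSet (G : SimplexCategoryᵒᵖ ⥤ Cat.{v, u}) where
  /-- the objects -/
  carrier (k : SimplexCategoryᵒᵖ) : Set (G.obj k)
  map_mem {k l : SimplexCategoryᵒᵖ} (f : k ⟶ l) {a : G.obj k} (ha : a ∈ carrier k) :
    (G.map f).toFunctor.obj a ∈ carrier l

namespace SimplicialObjectSet

variable {G : SimplexCategoryᵒᵖ ⥤ Cat.{v, u}} (A : SimplicialObjectSet G)

/-- The bisimplicial set of chains of isomorphisms between the given objects. -/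
def chains : BisimplicialSubset (G ⋙ isoNerve) where
  obj k :=
    { obj := fun n => {F | ∀ i, (show Core (G.obj k) from
        (show ComposableArrows (Core (G.obj k)) n.unop.len from F).obj i).of ∈ A.carrier k}
      map := fun _ _ hF _ => hF _ }
  map_mem f _ _ hF i := A.map_mem f (hF i)

/-- The isomorphisms with source in `A` surject onto the objects of `G` by taking targets; a section
compatible with degeneracies is the required choice. -/
theorem exists_approximation (hA : ∀ k (u : G.obj k), ∃ a ∈ A.carrier k, Nonempty (a ≅ u)) :
    ∃ S : ∀ k : SimplexCategory, Core (G.obj (op k)) → Arrow (Core (G.obj (op k))),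
      (∀ k u, (S k u).right = u) ∧ (∀ k u, (S k u).left.of ∈ A.carrier (op k)) ∧
      ∀ {k l : SimplexCategory} (f : l ⟶ k) [Epi f] (u : Core (G.obj (op k))),
        S l ((G.map f.op).toFunctor.core.obj u) =
          (G.map f.op).toFunctor.core.mapArrow.obj (S k u) := by
  obtain ⟨S, hS, hS'⟩ := SSet.exists_section_of_surjective (G ⋙ Cat.objects)
    (E := fun k => {e : Arrow (Core (G.obj (op k))) // e.left.of ∈ A.carrier (op k)})
    (fun k e => e.1.right.of)
    (fun f e => ⟨(G.map f.op).toFunctor.core.mapArrow.obj e.1, A.map_mem f.op e.2⟩)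
    (fun g f e => Subtype.ext (by
      dsimp only
      rw [op_comp, CategoryTheory.Functor.map_comp]
      rfl))
    (fun f e => rfl)
    (fun k u => by
      obtain ⟨a, ha, ⟨i⟩⟩ := hA (op k) u
      exact ⟨⟨Arrow.mk (CoreHom.mk i : (⟨a⟩ : Core (G.obj (op k))) ⟶ ⟨u⟩), ha⟩, rfl⟩)
  exact ⟨fun k u => (S k u.of).1, fun k u => congr_arg Core.mk (hS k u.of),
    fun k u => (S k u.of).2, fun f _ u => congr_arg Subtype.val (hS' f u.of)⟩

section

variable {C : Type u} [Groupoid.{v} C] (S : C → Arrow C) (hS : ∀ c, (S c).right = c)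

include hS in
theorem ite_right {n : SimplexCategoryᵒᵖ} (F : ComposableArrows C n.unop.len)
    (t : n.unop ⟶ ⦋1⦌) (j : Fin (n.unop.len + 1)) :
    (if t.toOrderHom j = 0 then S (F.obj j) else Arrow.mk (𝟙 (F.obj j))).right = F.obj j := by
  split_ifs
  · exact hS _
  · rfl

/-- The homotopy on the nerve of a groupoid that conjugates by a family of morphisms. -/
noncomputable def conjugationHomotopy : nerve C ⊗ Δ[1] ⟶ nerve C where
  app n := TypeCat.ofHom fun p =>
    Functor.conjugate (show ComposableArrows C n.unop.len from p.1)
      (fun j => if (stdSimplex.objEquiv p.2).toOrderHom j = 0 then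
        S ((show ComposableArrows C n.unop.len from p.1).obj j) else Arrow.mk (𝟙 _))
      (ite_right S hS _ _)
  naturality _ _ _ := rfl

theorem conjugationHomotopy_comp {D : Type u} [Groupoid.{v} D] (H : C ⥤ D) (S' : D → Arrow D)
    (hS' : ∀ d, (S' d).right = d) (h : ∀ c, S' (H.obj c) = H.mapArrow.obj (S c))
    {n : SimplexCategoryᵒᵖ} (F : ComposableArrows C n.unop.len)
    (t : (Δ[1] : SSet.{max u v}).obj n) :
    (conjugationHomotopy S' hS').app n ((nerveMap H).app n F, t) =
      (nerveMap H).app n ((conjugationHomotopy S hS).app n (F, t)) := by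
  refine Eq.trans ?_ (F.conjugate_comp _ (ite_right S hS F (stdSimplex.objEquiv t)) H)
  refine (F ⋙ H).conjugate_congr _ (funext fun j => ?_)
  change (if _ then S' (H.obj _) else _) = _
  rw [apply_ite H.mapArrow.obj, ← h]
  congr 1
  exact congr_arg Arrow.mk (H.map_id _).symm

end

/-- The inclusion of the chains of isomorphisms between the objects of `A` is anodyne if each
object is isomorphic to one of `A`. -/
theorem anodyneExtensions_chains
    (hA : ∀ k (u : G.obj k), ∃ a ∈ A.carrier k, Nonempty (a ≅ u)) :
    anodyneExtensions A.chains.diag.ι := by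
  obtain ⟨S, hS, hSA, hSepi⟩ := A.exists_approximation hA
  have hite : ∀ (k : SimplexCategory) (p : Prop) [Decidable p]
      (a b : Arrow (Core (G.obj (op k)))), (p → a.left.of ∈ A.carrier (op k)) →
      (¬ p → b.left.of ∈ A.carrier (op k)) → (if p then a else b).left.of ∈ A.carrier (op k) := by
    intro k p _ a b ha hb
    split_ifs with hp
    · exact ha hp
    · exact hb hp
  refine A.chains.anodyneExtensions_diag (fun k => conjugationHomotopy (S k) (hS k)) (fun k => ?_)
    ?_
  -- At the end `1` all conjugating arrows are identities; at the end `0` every object is replaced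
  -- by one of `A`. In between, each object is either replaced or kept, so chains in `A` stay in
  -- `A`.
  · refine ⟨?_, fun n F i => ?_, fun n F t hF i => ?_⟩
    · ext n F
      exact Functor.conjugate_id (show ComposableArrows (Core (G.obj (op k))) n.unop.len from F)
    · exact hite _ _ _ _ (fun _ => hSA _ _) fun h => absurd rfl h
    · exact hite _ _ _ _ (fun _ => hSA _ _) fun _ => hF i
  · intro k l f _ n F t
    exact conjugationHomotopy_comp (S k) (hS k) _ (S l) (hS l) (hSepi f) F t

end SimplicialObjectSet

end

/-! ### Levelwise equivalences of simplicial categories -/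

section

open Simplicial SSet HomotopicalAlgebra Opposite MonoidalCategory Limits

namespace CategoryTheory

theorem Functor.comp_injective_of_faithful {J C D : Type*} [Category* J] [Category* C]
    [Category* D] (H : C ⥤ D) [H.Faithful] (hH : Function.Injective H.obj) :
    Function.Injective (fun F : J ⥤ C => F ⋙ H) := by
  intro F F' h
  refine CategoryTheory.Functor.ext (fun j => hH (Functor.congr_obj h j)) fun i j f =>
    H.map_injective ?_
  have := Functor.congr_hom h f
  simpa [eqToHom_map] using this

theorem Functor.exists_comp_eq_of_full {J C D : Type*} [Category* J] [Category* C] [Category* D]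
    (H : C ⥤ D) [H.Full] [H.Faithful] (K : J ⥤ D) (hK : ∀ j, ∃ c, H.obj c = K.obj j) :
    ∃ F : J ⥤ C, F ⋙ H = K := by
  choose c hc using hK
  refine ⟨{ obj := c
            map := fun {i j} f => H.preimage (eqToHom (hc i) ≫ K.map f ≫ eqToHom (hc j).symm)
            map_id := fun j => H.map_injective (by simp)
            map_comp := fun f g => H.map_injective (by simp) }, ?_⟩
  exact CategoryTheory.Functor.ext hc fun i j f => by simp

instance Functor.core_faithful {C D : Type*} [Category* C] [Category* D] (H : C ⥤ D)
    [H.Faithful] : H.core.Faithful where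
  map_injective {x y} f g h := by
    apply CoreHom.ext
    apply Iso.ext
    apply H.map_injective
    exact congr_arg (fun k : H.core.obj x ⟶ H.core.obj y => k.iso.hom) h

instance Functor.core_full {C D : Type*} [Category* C] [Category* D] (H : C ⥤ D)
    [H.Full] [H.Faithful] : H.core.Full where
  map_surjective f := ⟨CoreHom.mk (H.preimageIso f.iso), by
    apply CoreHom.ext
    apply Iso.ext
    exact H.map_preimage f.iso.hom⟩

/-- Objects have to be compared separately, since `f` may identify distinct objects. -/
theorem InducedCategory.functor_ext {X C D : Type*} [Category* X] [Category* D] {f : C → D}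
    {F F' : X ⥤ InducedCategory D f} (hobj : ∀ x, F.obj x = F'.obj x)
    (h : F ⋙ inducedFunctor f = F' ⋙ inducedFunctor f) : F = F' := by
  refine CategoryTheory.Functor.ext hobj fun x y g => (inducedFunctor f).map_injective ?_
  have := Functor.congr_hom h g
  simpa [eqToHom_map] using this

end CategoryTheory

/-- A levelwise equivalence of simplicial categories that is injective on objects induces an
anodyne extension. -/
theorem anodyneExtensions_diagIsoNerve_map {G H : SimplexCategoryᵒᵖ ⥤ Cat.{v, u}} (i : G ⟶ H)
    [∀ k, (i.app k).toFunctor.IsEquivalence]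
    (hi : ∀ k, Function.Injective (i.app k).toFunctor.obj) :
    anodyneExtensions (diagIsoNerve.map i) := by
  let A : SimplicialObjectSet H :=
    { carrier := fun k => Set.range (i.app k).toFunctor.obj
      map_mem := by
        rintro k l f _ ⟨x, rfl⟩
        exact ⟨(G.map f).toFunctor.obj x,
          Functor.congr_obj (congr_arg Cat.Hom.toFunctor (i.naturality f)) x⟩ }
  have hcore : ∀ k, Function.Injective (i.app k).toFunctor.core.obj := fun k x y h =>
    congr_arg Core.mk (hi k (congr_arg Core.of h))
  have hA : anodyneExtensions A.chains.diag.ι := A.anodyneExtensions_chains fun k u =>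
    ⟨_, ⟨_, rfl⟩, ⟨(i.app k).toFunctor.objObjPreimageIso u⟩⟩
  have : Mono (diagIsoNerve.map i) := by
    refine (NatTrans.mono_iff_mono_app _).2 fun n => (mono_iff_injective _).2 ?_
    exact Functor.comp_injective_of_faithful (J := Fin (n.unop.len + 1))
      (i.app n).toFunctor.core (hcore n)
  -- Since `i` is levelwise fully faithful, a chain of isomorphisms lifts as soon as its objects do.
  have hrange : Subfunctor.range (diagIsoNerve.map i) = A.chains.diag := by
    ext n K
    constructor
    · rintro ⟨F, rfl⟩ j
      exact ⟨_, rfl⟩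
    · intro hK
      exact Functor.exists_comp_eq_of_full (J := Fin (n.unop.len + 1)) (i.app n).toFunctor.core K
        fun j => (hK j).imp' Core.mk fun _ h => congr_arg Core.mk h
  rw [← Subfunctor.toRange_ι (diagIsoNerve.map i)]
  refine MorphismProperty.comp_mem _ _ _ (.of_isIso _) ?_
  rw [hrange]
  exact hA

/-! ### Mapping cylinders of simplicial categories. -/

namespace CylinderCategory

variable {G G' : SimplexCategoryᵒᵖ ⥤ Cat.{v, u}} (φ : G ⟶ G')

/-- The objects over an object of `G'`, coming from `G` or from `G'`. -/
abbrev Obj (k : SimplexCategoryᵒᵖ) : Type u :=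
  {p : (G.obj k ⊕ G'.obj k) × G'.obj k // Sum.elim (φ.app k).toFunctor.obj id p.1 = p.2}

/-- The objects of the mapping cylinder. -/
abbrev proj (k : SimplexCategoryᵒᵖ) (p : Obj φ k) : G'.obj k := p.1.2

theorem naturality_obj {k l : SimplexCategoryᵒᵖ} (f : k ⟶ l) (x : G.obj k) :
    (φ.app l).toFunctor.obj ((G.map f).toFunctor.obj x) =
      (G'.map f).toFunctor.obj ((φ.app k).toFunctor.obj x) :=
  Functor.congr_obj (congr_arg Cat.Hom.toFunctor (φ.naturality f)) x

/-- The simplicial operators on the objects of the mapping cylinder. -/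
def mapObj {k l : SimplexCategoryᵒᵖ} (f : k ⟶ l) (p : Obj φ k) : Obj φ l :=
  ⟨(Sum.map (G.map f).toFunctor.obj (G'.map f).toFunctor.obj p.1.1,
    (G'.map f).toFunctor.obj p.1.2), by
    obtain ⟨⟨x | y, z⟩, h⟩ := p
    · exact (naturality_obj φ f x).trans (congr_arg (G'.map f).toFunctor.obj h)
    · exact congr_arg (G'.map f).toFunctor.obj h⟩

/-- The simplicial operators on the mapping cylinder. -/
def mapFunctor {k l : SimplexCategoryᵒᵖ} (f : k ⟶ l) :
    InducedCategory (G'.obj k) (proj φ k) ⥤ InducedCategory (G'.obj l) (proj φ l) where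
  obj := mapObj φ f
  map g := InducedCategory.homMk ((G'.map f).toFunctor.map g.hom)

/-- The mapping cylinder of a map of simplicial categories. -/
def cylinder : SimplexCategoryᵒᵖ ⥤ Cat.{v, u} where
  obj k := Cat.of (InducedCategory (G'.obj k) (proj φ k))
  map f := (mapFunctor φ f).toCatHom
  map_id k := by
    apply Cat.ext
    apply InducedCategory.functor_ext
    · rintro ⟨⟨x | y, z⟩, h⟩ <;> refine Subtype.ext (Prod.ext ?_ ?_)
      · change Sum.inl ((G.map (𝟙 k)).toFunctor.obj x) = Sum.inl x
        rw [CategoryTheory.Functor.map_id]; rfl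
      · change (G'.map (𝟙 k)).toFunctor.obj z = z
        rw [CategoryTheory.Functor.map_id]; rfl
      · change Sum.inr ((G'.map (𝟙 k)).toFunctor.obj y) = Sum.inr y
        rw [CategoryTheory.Functor.map_id]; rfl
      · change (G'.map (𝟙 k)).toFunctor.obj z = z
        rw [CategoryTheory.Functor.map_id]; rfl
    · change inducedFunctor (proj φ k) ⋙ (G'.map (𝟙 k)).toFunctor = _
      rw [CategoryTheory.Functor.map_id]
      rfl
  map_comp {k l m} f g := by
    apply Cat.ext
    apply InducedCategory.functor_ext
    · rintro ⟨⟨x | y, z⟩, h⟩ <;> refine Subtype.ext (Prod.ext ?_ ?_)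
      · change Sum.inl ((G.map (f ≫ g)).toFunctor.obj x) = _
        rw [CategoryTheory.Functor.map_comp]; rfl
      · change (G'.map (f ≫ g)).toFunctor.obj z = _
        rw [CategoryTheory.Functor.map_comp]; rfl
      · change Sum.inr ((G'.map (f ≫ g)).toFunctor.obj y) = _
        rw [CategoryTheory.Functor.map_comp]; rfl
      · change (G'.map (f ≫ g)).toFunctor.obj z = _
        rw [CategoryTheory.Functor.map_comp]; rfl
    · change inducedFunctor (proj φ k) ⋙ (G'.map (f ≫ g)).toFunctor = _
      rw [CategoryTheory.Functor.map_comp]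
      rfl

/-- The inclusion of the source into the mapping cylinder. -/
def inl : G ⟶ cylinder φ where
  app k := Functor.toCatHom (D := InducedCategory (G'.obj k) (proj φ k))
    { obj := fun x => ⟨(Sum.inl x, (φ.app k).toFunctor.obj x), rfl⟩
      map := fun g => InducedCategory.homMk ((φ.app k).toFunctor.map g) }
  naturality k l f := by
    apply Cat.ext
    apply InducedCategory.functor_ext
    · exact fun x => Subtype.ext (Prod.ext rfl (naturality_obj φ f x))
    · exact congr_arg Cat.Hom.toFunctor (φ.naturality f)

/-- The inclusion of the target into the mapping cylinder. -/
def inr : G' ⟶ cylinder φ where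
  app k := Functor.toCatHom (D := InducedCategory (G'.obj k) (proj φ k))
    { obj := fun y => ⟨(Sum.inr y, y), rfl⟩
      map := fun g => InducedCategory.homMk g }

/-- The projection of the mapping cylinder to the target. -/
def toTarget : cylinder φ ⟶ G' where
  app k := (inducedFunctor (proj φ k)).toCatHom

theorem inl_toTarget : inl φ ≫ toTarget φ = φ := rfl

theorem inr_toTarget : inr φ ≫ toTarget φ = 𝟙 G' := rfl

instance (k : SimplexCategoryᵒᵖ) : ((toTarget φ).app k).toFunctor.IsEquivalence where
  full := InducedCategory.full (proj φ k)
  faithful := InducedCategory.faithful (proj φ k)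
  essSurj := ⟨fun y => ⟨(⟨(Sum.inr y, y), rfl⟩ : Obj φ k), ⟨Iso.refl y⟩⟩⟩

instance (k : SimplexCategoryᵒᵖ) : ((inr φ).app k).toFunctor.IsEquivalence := by
  have : (((inr φ).app k).toFunctor ⋙ ((toTarget φ).app k).toFunctor).IsEquivalence :=
    inferInstanceAs (𝟭 (G'.obj k)).IsEquivalence
  exact Functor.isEquivalence_of_comp_right _ ((toTarget φ).app k).toFunctor

instance (k : SimplexCategoryᵒᵖ) [h : (φ.app k).toFunctor.IsEquivalence] :
    ((inl φ).app k).toFunctor.IsEquivalence := by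
  have : (((inl φ).app k).toFunctor ⋙ ((toTarget φ).app k).toFunctor).IsEquivalence := h
  exact Functor.isEquivalence_of_comp_right _ ((toTarget φ).app k).toFunctor

end CylinderCategory

open CylinderCategory in
/-- A levelwise equivalence of simplicial categories has the relative cube lifting property after
realization. -/
theorem hasRelativeCubeLifting_diagIsoNerve_map {G G' : SimplexCategoryᵒᵖ ⥤ Cat.{v, u}}
    (φ : G ⟶ G') [∀ k, (φ.app k).toFunctor.IsEquivalence] :
    HasRelativeCubeLifting (SSet.toTop.map (diagIsoNerve.map φ)).hom := by
  have hl : anodyneExtensions (diagIsoNerve.map (inl φ)) :=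
    anodyneExtensions_diagIsoNerve_map _ fun k x y h =>
      Sum.inl_injective (congr_arg (fun p : Obj φ k => p.1.1) h)
  have hr : anodyneExtensions (diagIsoNerve.map (inr φ)) :=
    anodyneExtensions_diagIsoNerve_map _ fun k x y h =>
      Sum.inr_injective (congr_arg (fun p : Obj φ k => p.1.1) h)
  have h₁ := hl.hasRelativeCubeLifting
  -- The projection is not injective on objects, but it retracts the anodyne extension given by
  -- `inr`.
  have h₂ := hr.hasRelativeCubeLifting_of_comp_eq_id (q := diagIsoNerve.map (toTarget φ)) (by
    rw [← CategoryTheory.Functor.map_comp, inr_toTarget, CategoryTheory.Functor.map_id])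
  have h₃ : SSet.toTop.map (diagIsoNerve.map φ) =
      SSet.toTop.map (diagIsoNerve.map (inl φ)) ≫
        SSet.toTop.map (diagIsoNerve.map (toTarget φ)) := by
    rw [← CategoryTheory.Functor.map_comp, ← CategoryTheory.Functor.map_comp, inl_toTarget]
  rw [h₃]
  exact h₂.comp h₁

end

/-! ### Equivalences of derivators -/

section

open Limits

namespace CategoryTheory

/-- The mate of an isomorphism between right adjoints along two equivalences is an isomorphism. -/
theorem mateEquiv_symm_isIso_app {C D E F : Type*} [Category* C] [Category* D] [Category* E]
    [Category* F] {L₁ : C ⥤ D} {R₁ : D ⥤ C} {L₂ : E ⥤ F} {R₂ : F ⥤ E} {G : C ⥤ E} {H : D ⥤ F}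
    (adj₁ : L₁ ⊣ R₁) (adj₂ : L₂ ⊣ R₂) (α : TwoSquare R₁ H G R₂) [∀ d, IsIso (α.natTrans.app d)]
    [G.IsEquivalence] [H.IsEquivalence] (c : C) :
    IsIso (((mateEquiv adj₁ adj₂).symm α).natTrans.app c) := by
  let β : L₂.obj (G.obj c) ⟶ H.obj (L₁.obj c) := ((mateEquiv adj₁ adj₂).symm α).natTrans.app c
  have hβ : adj₂.unit.app (G.obj c) ≫ R₂.map β =
      G.map (adj₁.unit.app c) ≫ α.natTrans.app (L₁.obj c) :=
    (unit_mateEquiv_symm adj₁ adj₂ α c).symm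
  -- Under the adjunctions, precomposition with `β` becomes the action of `G` on morphisms followed
  -- by `α`. Full faithfulness of `G` and `H` makes it bijective on maps into objects `H.obj d`,
  -- which suffice up to isomorphism.
  have key : ∀ (d : D) (h : L₁.obj c ⟶ d),
      adj₂.homEquiv _ _ (β ≫ H.map h) = G.map (adj₁.homEquiv _ _ h) ≫ α.natTrans.app d := by
    intro d h
    have hα : G.map (R₁.map h) ≫ α.natTrans.app d =
      α.natTrans.app (L₁.obj c) ≫ R₂.map (H.map h) := α.natTrans.naturality h
    rw [Adjunction.homEquiv_unit, Adjunction.homEquiv_unit, R₂.map_comp, ← Category.assoc, hβ,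
      G.map_comp, Category.assoc, Category.assoc, hα]
  have bij : ∀ d : D, Function.Bijective fun x : H.obj (L₁.obj c) ⟶ H.obj d => β ≫ x := by
    intro d
    constructor
    · intro x y hxy
      obtain ⟨x, rfl⟩ := H.map_surjective x
      obtain ⟨y, rfl⟩ := H.map_surjective y
      have h : β ≫ H.map x = β ≫ H.map y := hxy
      have h' := congr_arg (adj₂.homEquiv _ _) h
      rw [key, key, cancel_mono] at h'
      rw [(adj₁.homEquiv _ _).injective (G.map_injective h')]
    · intro y
      obtain ⟨g, hg⟩ := G.map_surjective (adj₂.homEquiv _ _ y ≫ inv (α.natTrans.app d))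
      refine ⟨H.map ((adj₁.homEquiv _ _).symm g), (adj₂.homEquiv _ _).injective ?_⟩
      dsimp only
      rw [key, Equiv.apply_symm_apply, hg, Category.assoc, IsIso.inv_hom_id, Category.comp_id]
  change IsIso β
  rw [isIso_iff_coyoneda_map_bijective]
  intro T
  let e := H.objObjPreimageIso T
  constructor
  · intro x y h
    have h' : β ≫ x = β ≫ y := h
    rw [← cancel_mono e.inv]
    apply (bij _).1
    dsimp only
    rw [← Category.assoc, h', Category.assoc]
  · intro y
    obtain ⟨x, hx⟩ := (bij _).2 (y ≫ e.inv)
    refine ⟨x ≫ e.hom, ?_⟩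
    dsimp only at hx ⊢
    rw [← Category.assoc, hx, Category.assoc, e.inv_hom_id, Category.comp_id]

end CategoryTheory

namespace Prederivator

variable {Dia : DiagramCategory.{w}}

theorem StrictHom.IsEquivalence.isCocontinuous {D D' : Prederivator.{w, v, u} Dia}
    [D.HasLeftKan] [D'.HasLeftKan] {φ : StrictHom D D'} (hφ : φ.IsEquivalence) :
    φ.IsCocontinuous := by
  intro X Y f
  have := hφ X
  have := hφ Y
  have (d : D.obj Y) : IsIso ((TwoSquare.mk (D.map f) (φ.app Y) (φ.app X) (D'.map f)
    (eqToHom (φ.comm f))).natTrans.app d) :=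
    inferInstanceAs (IsIso ((eqToHom (φ.comm f)).app d))
  have (c : D.obj X) : IsIso ((φ.lanComparison f).app c) :=
    mateEquiv_symm_isIso_app (D.lanAdj f) (D'.lanAdj f)
      (TwoSquare.mk (D.map f) (φ.app Y) (φ.app X) (D'.map f) (eqToHom (φ.comm f))) c
  exact NatIso.isIso_of_isIso_app _

variable {D : Prederivator.{w, v, u} Dia} [D.HasLeftKan]

theorem IsCocartesian.of_iso {F G : D.obj Dia.Sq} (hF : D.IsCocartesian F) (e : F ≅ G) :
    D.IsCocartesian G := by
  have : IsIso ((D.lanAdj Dia.cornerIncl).counit.app F) := hF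
  have h := (D.lanAdj Dia.cornerIncl).counit.naturality e.hom
  have : IsIso ((D.map Dia.cornerIncl ⋙ D.lan Dia.cornerIncl).map e.hom ≫
      (D.lanAdj Dia.cornerIncl).counit.app G) := by
    rw [h]
    have : IsIso ((𝟭 (D.obj Dia.Sq)).map e.hom) := inferInstanceAs (IsIso e.hom)
    infer_instance
  exact IsIso.of_isIso_comp_left ((D.map Dia.cornerIncl ⋙ D.lan Dia.cornerIncl).map e.hom) _

theorem IsSObject.of_iso {n : SimplexCategory} {F G : D.obj (Dia.Ar n)} (hF : D.IsSObject n F)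
    (e : F ≅ G) : D.IsSObject n G where
  isZero i := (hF.isZero i).of_iso ((D.map _).mapIso e.symm)
  isCocartesian i j k hij hjk := (hF.isCocartesian i j k hij hjk).of_iso ((D.map _).mapIso e)

end Prederivator

namespace CocontinuousStrictHom

variable {Dia : DiagramCategory.{w}} {D D' : PointedRightDerivator.{w, v, u} Dia}
  (φ : CocontinuousStrictHom D D') (hφ : φ.IsEquivalence)

include hφ

/-- The mate identity expresses `φ` of the counit of `D` through the counit of `D'` and
isomorphisms, and an equivalence reflects isomorphisms. -/
theorem isCocartesian_of_app {F : D.obj Dia.Sq}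
    (hF : D'.IsCocartesian ((φ.app Dia.Sq).obj F)) : D.IsCocartesian F := by
  have h := mateEquiv_counit_symm (D.lanAdj Dia.cornerIncl) (D'.lanAdj Dia.cornerIncl)
    (TwoSquare.mk _ _ _ _ (eqToHom (φ.comm Dia.cornerIncl))) F
  have := φ.isCocontinuous Dia.cornerIncl
  have := hφ Dia.Sq
  have : IsIso ((D'.lanAdj Dia.cornerIncl).counit.app ((φ.app Dia.Sq).obj F)) := hF
  have h₁ : IsIso ((φ.toStrictHom.lanComparison Dia.cornerIncl).app
      ((D.map Dia.cornerIncl).obj F)) := inferInstance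
  have h₂ : IsIso ((D'.lan Dia.cornerIncl).map ((eqToHom (φ.comm Dia.cornerIncl)).app F)) :=
    inferInstance
  change (D'.lan Dia.cornerIncl).map ((eqToHom (φ.comm Dia.cornerIncl)).app F) ≫ _ =
    (φ.toStrictHom.lanComparison Dia.cornerIncl).app _ ≫ _ at h
  have h₃ : IsIso ((φ.toStrictHom.lanComparison Dia.cornerIncl).app
      ((D.map Dia.cornerIncl).obj F) ≫
      (φ.app Dia.Sq).map ((D.lanAdj Dia.cornerIncl).counit.app F)) := by
    rw [← h]
    exact IsIso.comp_isIso' h₂ this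
  have h₄ : IsIso ((φ.app Dia.Sq).map ((D.lanAdj Dia.cornerIncl).counit.app F)) :=
    IsIso.of_isIso_comp_left
      ((φ.toStrictHom.lanComparison Dia.cornerIncl).app ((D.map Dia.cornerIncl).obj F)) _
  exact isIso_of_reflects_iso _ (φ.app Dia.Sq)

theorem isSObject_of_app {n : SimplexCategory} {F : D.obj (Dia.Ar n)}
    (hF : D'.IsSObject n ((φ.app (Dia.Ar n)).obj F)) : D.IsSObject n F where
  isZero i := by
    have := hφ Dia.pt
    have h := hF.isZero i
    rw [← φ.map_obj] at h
    exact IsZero.of_full_of_faithful_of_isZero (φ.app Dia.pt) _ h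
  isCocartesian i j k hij hjk := by
    have h := hF.isCocartesian i j k hij hjk
    rw [← φ.map_obj] at h
    exact φ.isCocartesian_of_app hφ h

/-- A preimage up to isomorphism of an object of `S_n D'` lies in `S_n D`, because the conditions
are invariant under isomorphism and reflected by `φ`. -/
theorem sApp_isEquivalence (n : SimplexCategory) : (φ.sApp n).IsEquivalence := by
  have := hφ (Dia.Ar n)
  have : (φ.sApp n).EssSurj := ⟨fun F => by
    let e := (φ.app (Dia.Ar n)).objObjPreimageIso F.obj
    exact ⟨⟨_, φ.isSObject_of_app hφ (F.property.of_iso e.symm)⟩,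
      ⟨ObjectProperty.isoMk _ e⟩⟩⟩
  exact { }

theorem hasRelativeCubeLifting_deloopedKMap : HasRelativeCubeLifting φ.deloopedKMap.hom := by
  have (k : SimplexCategoryᵒᵖ) : (φ.sConstructionMap.app k).toFunctor.IsEquivalence :=
    φ.sApp_isEquivalence hφ k.unop
  exact hasRelativeCubeLifting_diagIsoNerve_map φ.sConstructionMap

end CocontinuousStrictHom

end

theorem mainTheorem8 {Dia : DiagramCategory.{w}} (D D' : PointedRightDerivator.{w, v, u} Dia)
    (φ : Prederivator.StrictHom D.toPrederivator D'.toPrederivator) (hφ : φ.IsEquivalence) :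
    ∃ hc : φ.IsCocontinuous, ∀ z : D.S (SimplexCategory.mk 0),
      IsWeakHomotopyEquivalence
        (CocontinuousStrictHom.KMap (⟨φ, hc⟩ : CocontinuousStrictHom D D') z) :=
  ⟨hφ.isCocontinuous, fun z =>
    ((CocontinuousStrictHom.hasRelativeCubeLifting_deloopedKMap _ hφ).loopSpaceMap
      (CocontinuousStrictHom.deloopedKMap_basepoint _ z)).isWeakHomotopyEquivalence⟩
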